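/- Let $0<q<1$, $\alpha\in\mathbb{R}\setminus\{0\}$ and $\beta>0$. Write $(a;p)_n=\prod_{k=0}^{n-1}(1-ap^k)$ and $(a;p)_{-n}=\prod_{k=1}^{n}(1-ap^{-k})^{-1}$ for $n\ge 0$, $(a;p)_\infty=\prod_{k\ge0}(1-ap^k)$ for $|p|<1$, and $(a_1,\dots,a_r;p)_n=\prod_j (a_j;p)_n$ (also for $n=\infty$). Let $$x_l(\alpha)=\tfrac12\Bigl(\frac1{\alpha q^l}-\alpha q^l\Bigr),\qquad l\in\mathbb{Z}.$$ For $n\ge0$ and $p=q^{-1}$ let $$P_n(u;a,b\,|\,p)=\frac{(ab;p)_n}{a^n}\sum_{k=0}^n\frac{(p^{-n},au,a/u;p)_k}{(ab,p;p)_k}\,p^k$$ be the Al-Salam--Chihara polynomials in base $q^{-1}$, and let the symmetric Al-Salam--Chihara polynomials be $$h_n^{(\beta)}(x|q)=i^n P_n\bigl(ie^{-y};\sqrt\beta,-\sqrt\beta\,|\,q^{-1}\bigr),\qquad x=\sinh y,\ y\in\mathbb{R}.$$ Then for all integers $n,m\ge0$ the following two series converge absolutely and $$\sum_{l=-\infty}^\infty\frac{(-\alpha^2/\beta;q^2)_l}{(-\alpha^2\beta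 q^2;q^2)_l}\,\alpha^{2l}\beta^l(1+\alpha^2q^{2l})q^{l^2}\, h_n^{(\beta)}(x_l(\alpha)|q)\,h_m^{(\beta)}(x_l(\alpha)|q) =\delta_{n,m}\frac{\beta^n(-1/\beta,q;q)_n}{q^{n^2}}\, \frac{(-\alpha^2,-q/\alpha^2,-\beta q,q;q)_\infty}{(-\alpha^2\beta q^2,-\beta q^2/\alpha^2;q^2)_\infty},$$ $$\sum_{l=-\infty}^\infty(-1)^l\alpha^{2l}(1+\alpha^2q^{2l})q^{l(l-1)}\, h_n^{(\beta)}(x_l(\alpha)|q)\,h_m^{(1/(\beta q^2))}(x_l(\alpha)|q)=0.$$ -/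

import Mathlib

noncomputable section

/-- The finite `q`-shifted factorial `(a;q)_n = ∏_{k=0}^{n-1} (1 - a q^k)`, `n ∈ ℕ`. -/
def qPoch {K : Type*} [Field K] (a q : K) (n : ℕ) : K :=
  ∏ k ∈ Finset.range n, (1 - a * q ^ k)

/-- The `q`-shifted factorial `(a;q)_l` with `l ∈ ℤ`; for negative index,
`(a;q)_{-n} = 1 / ((1 - a q^{-1}) (1 - a q^{-2}) ⋯ (1 - a q^{-n}))`. -/
def qPochZ {K : Type*} [Field K] (a q : K) : ℤ → K
  | Int.ofNat n => qPoch a q n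
  | Int.negSucc n => (∏ k ∈ Finset.range (n + 1), (1 - a * (q ^ (k + 1))⁻¹))⁻¹

/-- The infinite `q`-shifted factorial `(a;q)_∞ = ∏_{k ≥ 0} (1 - a q^k)`
(an absolutely convergent product for `|q| < 1`). -/
def qPochInf (a q : ℝ) : ℝ := ∏' k : ℕ, (1 - a * q ^ k)

/-- The terminating basic hypergeometric series
`₃φ₂(p^{-n}, b, c; d, e; p, z)`; its terms of index `k > n` vanish as `(p^{-n};p)_k = 0`. -/
def phi32 (n : ℕ) (b c d e p z : ℂ) : ℂ :=
  ∑ k ∈ Finset.range (n + 1),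
    qPoch ((p ^ n)⁻¹) p k * qPoch b p k * qPoch c p k /
      (qPoch d p k * qPoch e p k * qPoch p p k) * z ^ k

/-- The Al-Salam--Chihara polynomials
`P_n(u;a,b|p) = (ab;p)_n a^{-n} ₃φ₂(p^{-n}, au, a/u; ab, 0; p, p)` in base `p`. -/
def alSalamChihara (n : ℕ) (u a b p : ℂ) : ℂ :=
  qPoch (a * b) p n / a ^ n * phi32 n (a * u) (a / u) (a * b) 0 p p

/-- `Q_n(y;β|q) = i^n P_n(i e^{-y}; √β, -√β | q^{-1})`. -/
def symmASCQ (n : ℕ) (β q y : ℝ) : ℂ :=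
  Complex.I ^ n *
    alSalamChihara n (Complex.I * Complex.exp (-(y : ℂ)))
      ((Real.sqrt β : ℝ) : ℂ) (-((Real.sqrt β : ℝ) : ℂ)) ((q : ℂ)⁻¹)

/-- The symmetric Al-Salam--Chihara polynomials for base `q⁻¹`:
`h_n^{(β)}(x|q) = Q_n(y;β|q)` where `x = sinh y`. -/
def symmASC (n : ℕ) (β q x : ℝ) : ℂ := symmASCQ n β q (Real.arsinh x)

/-- The grid points `x_l(α) = (1/(α q^l) - α q^l)/2`, `l ∈ ℤ`. -/
def gridPt (q α : ℝ) (l : ℤ) : ℝ := (1 / (α * q ^ l) - α * q ^ l) / 2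

end

open Filter Topology

noncomputable section

/-! Put t = α q^l, so that 2 x_l = 1/t - t, and c = i√β. Up to a constant factor independent of l,
the first weight is `nodeWeight` · (1 + t²) · `nodeProd` c · `nodeProd` (-c) (`massTerm_eq_weight`).
It pays to study its total mass `nodeMass` for two free parameters c, d. A telescoping sum
(`hasSum_massTerm_mul_linear`) yields the functional equation `nodeMass_shift`; iterating it gives
(-cdq;q)_∞ times the mass at (0,0). That constant is read off at c = 1/α, d = -α, where a single
term of the series survives.

The polynomials φ_k = (ct, -c/t; q⁻¹)_k in 1/t - t turn `nodeProd` with parameter c into `nodeProd`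
with parameter c q^{-k}. Hence the sum of the weight against φ_k(c) φ_j(d) is again a mass, known in
closed form (`hasSum_massTerm_phiPoly`). Expanding h_n in φ_k(c) and testing against φ_j(-c)
produces a `q_chu_vandermonde` sum, which vanishes for j < n. As φ_j has degree j, this is
orthogonality, and j = n gives the norm after comparing leading coefficients.

The second weight annihilates every polynomial in 1/t - t, hence any product h_n h_m whatever the
two parameters. Its moments of orders s and -s differ by the factor -(-1)^s
(`alternatingMoment_neg`), which makes the binomial expansion of (1/t - t)^n cancel against its own
reversal. -/

/-- The infinite `q`-shifted factorial `(a;q)_∞` of a complex number `a`, with `q` real. -/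
def qPochInfC (a : ℂ) (q : ℝ) : ℂ := ∏' k : ℕ, (1 - a * (q : ℂ) ^ k)

/-! ### Infinite q-products: convergence, shifts, bounds -/

lemma summable_norm_mul_pow (a : ℂ) {q : ℝ} (hq0 : 0 < q) (hq1 : q < 1) :
    Summable fun k : ℕ => ‖-(a * (q : ℂ) ^ k)‖ := by
  have : (fun k : ℕ => ‖-(a * (q : ℂ) ^ k)‖) = fun k => ‖a‖ * q ^ k := by
    funext k
    simp [abs_of_pos hq0]
  rw [this]
  exact (summable_geometric_of_lt_one hq0.le hq1).mul_left _

lemma multipliable_qPochInfC (a : ℂ) {q : ℝ} (hq0 : 0 < q) (hq1 : q < 1) :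
    Multipliable fun k : ℕ => (1 - a * (q : ℂ) ^ k) := by
  simpa only [sub_eq_add_neg] using
    multipliable_one_add_of_summable (summable_norm_mul_pow a hq0 hq1)

lemma tendsto_qPochInfC (a : ℂ) {q : ℝ} (hq0 : 0 < q) (hq1 : q < 1) :
    Tendsto (fun n => qPoch a (q : ℂ) n) atTop (𝓝 (qPochInfC a q)) :=
  (multipliable_qPochInfC a hq0 hq1).tendsto_prod_tprod_nat

lemma multipliable_qPochInf (a : ℝ) {q : ℝ} (hq0 : 0 < q) (hq1 : q < 1) :
    Multipliable fun k : ℕ => (1 - a * q ^ k) := by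
  have : Summable fun k : ℕ => ‖-(a * q ^ k)‖ := by
    simpa using summable_norm_mul_pow (a : ℂ) hq0 hq1
  simpa only [sub_eq_add_neg] using multipliable_one_add_of_summable this

lemma tendsto_qPochInf (a : ℝ) {q : ℝ} (hq0 : 0 < q) (hq1 : q < 1) :
    Tendsto (fun n => qPoch a q n) atTop (𝓝 (qPochInf a q)) :=
  (multipliable_qPochInf a hq0 hq1).tendsto_prod_tprod_nat

lemma qPochInfC_ofReal (a : ℝ) {q : ℝ} (hq0 : 0 < q) (hq1 : q < 1) :
    qPochInfC (a : ℂ) q = ((qPochInf a q : ℝ) : ℂ) := by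
  refine tendsto_nhds_unique (tendsto_qPochInfC (a : ℂ) hq0 hq1) ?_
  have := (Complex.continuous_ofReal.tendsto _).comp (tendsto_qPochInf a hq0 hq1)
  refine this.congr fun n => ?_
  simp [qPoch]

lemma qPoch_succ_left {K : Type*} [Field K] (a q : K) (n : ℕ) :
    qPoch a q (n + 1) = (1 - a) * qPoch (a * q) q n := by
  unfold qPoch
  rw [Finset.prod_range_succ', mul_comm]
  simp only [pow_zero, mul_one]
  congr 1
  refine Finset.prod_congr rfl fun k _ => ?_
  ring

lemma qPoch_succ {K : Type*} [Field K] (a q : K) (n : ℕ) :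
    qPoch a q (n + 1) = qPoch a q n * (1 - a * q ^ n) :=
  Finset.prod_range_succ _ _

lemma qPochInfC_shift (a : ℂ) {q : ℝ} (hq0 : 0 < q) (hq1 : q < 1) :
    qPochInfC a q = (1 - a) * qPochInfC (a * q) q := by
  refine tendsto_nhds_unique ((tendsto_qPochInfC a hq0 hq1).comp (tendsto_add_atTop_nat 1)) ?_
  refine ((tendsto_qPochInfC (a * q) hq0 hq1).const_mul (1 - a)).congr fun n => ?_
  rw [Function.comp_apply, qPoch_succ_left]

lemma qPochInf_shift (a : ℝ) {q : ℝ} (hq0 : 0 < q) (hq1 : q < 1) :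
    qPochInf a q = (1 - a) * qPochInf (a * q) q := by
  have := qPochInfC_shift (a : ℂ) hq0 hq1
  rw [← Complex.ofReal_mul, qPochInfC_ofReal _ hq0 hq1, qPochInfC_ofReal _ hq0 hq1] at this
  exact_mod_cast this

lemma qPochInfC_one {q : ℝ} (hq0 : 0 < q) (hq1 : q < 1) : qPochInfC 1 q = 0 := by
  rw [qPochInfC_shift 1 hq0 hq1, sub_self, zero_mul]

@[simp] lemma qPochInfC_zero (q : ℝ) : qPochInfC 0 q = 1 := by
  simp [qPochInfC]

/-- The factor of index n is 1 - q^{-n} q^n. These zeros are what reduces `nodeMass` to one term in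
`nodeMass_inv_neg`. -/
lemma qPochInfC_inv_pow {q : ℝ} (hq0 : 0 < q) (hq1 : q < 1) (n : ℕ) :
    qPochInfC ((q : ℂ)⁻¹ ^ n) q = 0 := by
  induction n with
  | zero => simpa using qPochInfC_one hq0 hq1
  | succ n ih =>
    have hq : (q : ℂ) ≠ 0 := by exact_mod_cast hq0.ne'
    rw [qPochInfC_shift _ hq0 hq1, pow_succ, mul_assoc, inv_mul_cancel₀ hq, mul_one, ih, mul_zero]

lemma norm_qPochInfC_le (a : ℂ) {r q : ℝ} (hq0 : 0 < q) (hq1 : q < 1) (har : ‖a‖ ≤ r) :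
    ‖qPochInfC a q‖ ≤ qPochInf (-r) q := by
  refine le_of_tendsto_of_tendsto' (tendsto_qPochInfC a hq0 hq1).norm
    (tendsto_qPochInf (-r) hq0 hq1) fun n => ?_
  unfold qPoch
  rw [norm_prod]
  refine Finset.prod_le_prod (fun _ _ => norm_nonneg _) fun k _ => ?_
  refine (norm_sub_le _ _).trans ?_
  have : ‖a * (q : ℂ) ^ k‖ = ‖a‖ * q ^ k := by simp [abs_of_pos hq0]
  rw [this, norm_one, neg_mul, sub_neg_eq_add]
  gcongr

lemma one_le_qPochInf_neg {r q : ℝ} (hq0 : 0 < q) (hq1 : q < 1) (hr : 0 ≤ r) :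
    1 ≤ qPochInf (-r) q := by
  refine ge_of_tendsto' (tendsto_qPochInf (-r) hq0 hq1) fun n => ?_
  unfold qPoch
  refine Finset.one_le_prod fun k _ => ?_
  have : 0 ≤ r * q ^ k := by positivity
  simpa using this

lemma norm_qPochInfC_sub_one_le (a : ℂ) {q : ℝ} (hq0 : 0 < q) (hq1 : q < 1) :
    ‖qPochInfC a q - 1‖ ≤ Real.exp (‖a‖ * (1 - q)⁻¹) - 1 := by
  refine le_of_tendsto' ((tendsto_qPochInfC a hq0 hq1).sub_const 1).norm fun n => ?_
  have := Finset.norm_prod_one_add_sub_one_le (Finset.range n) fun k => -(a * (q : ℂ) ^ k)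
  simp only [← sub_eq_add_neg] at this
  refine this.trans ?_
  gcongr
  refine ((summable_norm_mul_pow a hq0 hq1).sum_le_tsum _ fun _ _ => norm_nonneg _).trans_eq ?_
  rw [← tsum_geometric_of_lt_one hq0.le hq1, ← tsum_mul_left]
  congr 1
  funext k
  simp [abs_of_pos hq0]

lemma tendsto_qPochInfC_zero {q : ℝ} (hq0 : 0 < q) (hq1 : q < 1) :
    Tendsto (fun a => qPochInfC a q) (𝓝 0) (𝓝 1) := by
  rw [tendsto_iff_norm_sub_tendsto_zero]
  refine squeeze_zero (fun _ => norm_nonneg _)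
    (fun a => norm_qPochInfC_sub_one_le a hq0 hq1) ?_
  have : Continuous fun a : ℂ => Real.exp (‖a‖ * (1 - q)⁻¹) - 1 := by fun_prop
  simpa using this.tendsto 0

lemma qPochInfC_mul_neg (a : ℂ) {q : ℝ} (hq0 : 0 < q) (hq1 : q < 1) :
    qPochInfC a q * qPochInfC (-a) q = qPochInfC (a ^ 2) (q ^ 2) := by
  have h2 : q ^ 2 < 1 := by nlinarith
  refine tendsto_nhds_unique ((tendsto_qPochInfC a hq0 hq1).mul (tendsto_qPochInfC (-a) hq0 hq1)) ?_
  refine (tendsto_qPochInfC (a ^ 2) (pow_pos hq0 2) h2).congr fun n => ?_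
  unfold qPoch
  rw [← Finset.prod_mul_distrib]
  refine Finset.prod_congr rfl fun k _ => ?_
  push_cast
  ring

/-! ### Nodes, the q⁻¹-Hermite weight, and summability -/

/-- The nodes `α q^l`, in terms of which the grid points are `(1/(α q^l) - α q^l)/2`. -/
def node (q α : ℝ) (l : ℤ) : ℝ := α * q ^ l

/-- The factor `α^{4l} q^{2l² - l}` of the `q⁻¹`-Hermite weight at the node `α q^l`. -/
def nodeWeight (q α : ℝ) (l : ℤ) : ℝ := α ^ (4 * l) * q ^ (2 * l ^ 2 - l)

lemma node_succ {q : ℝ} (hq0 : 0 < q) (α : ℝ) (l : ℤ) :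
    node q α (l + 1) = node q α l * q := by
  unfold node
  rw [zpow_add_one₀ hq0.ne', mul_assoc]

lemma node_ne_zero {q α : ℝ} (hq0 : 0 < q) (hα : α ≠ 0) (l : ℤ) : node q α l ≠ 0 :=
  mul_ne_zero hα (zpow_ne_zero _ hq0.ne')

lemma node_pos {q α : ℝ} (hq0 : 0 < q) (hα : 0 < α) (l : ℤ) : 0 < node q α l :=
  mul_pos hα (zpow_pos hq0 _)

lemma abs_node {q : ℝ} (hq0 : 0 < q) (α : ℝ) (l : ℤ) : |node q α l| = node q |α| l := by
  unfold node
  rw [abs_mul, abs_of_pos (zpow_pos hq0 l)]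

lemma nodeWeight_succ {q α : ℝ} (hq0 : 0 < q) (hα : α ≠ 0) (l : ℤ) :
    nodeWeight q α (l + 1) = nodeWeight q α l * (node q α l ^ 4 * q) := by
  unfold nodeWeight node
  have h1 : α ^ (4 * (l + 1)) = α ^ (4 * l) * α ^ 4 := by
    rw [mul_add, zpow_add₀ hα]; norm_cast
  have h2 : q ^ (2 * (l + 1) ^ 2 - (l + 1)) = q ^ (2 * l ^ 2 - l) * (q ^ l) ^ 4 * q := by
    rw [← zpow_natCast (q ^ l) 4, ← zpow_mul, ← zpow_add₀ hq0.ne', ← zpow_add_one₀ hq0.ne']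
    congr 1
    push_cast
    ring
  rw [h1, h2]
  ring

lemma nodeWeight_pos {q α : ℝ} (hq0 : 0 < q) (hα : 0 < α) (l : ℤ) : 0 < nodeWeight q α l :=
  mul_pos (zpow_pos hα _) (zpow_pos hq0 _)

lemma abs_nodeWeight {q : ℝ} (hq0 : 0 < q) (α : ℝ) (l : ℤ) :
    |nodeWeight q α l| = nodeWeight q |α| l := by
  unfold nodeWeight
  rw [abs_mul, abs_of_pos (zpow_pos hq0 _), abs_zpow]

/-- The product `∏_{k ≥ 1} (1 + r q^k τ)(1 + r q^k / τ)`, which dominates `nodeProd`. -/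
def nodeBound (q r τ : ℝ) : ℝ := qPochInf (-(r * q * τ)) q * qPochInf (-(r * q / τ)) q

lemma nodeBound_pos {q r τ : ℝ} (hq0 : 0 < q) (hq1 : q < 1) (hr : 0 ≤ r) (hτ : 0 < τ) :
    0 < nodeBound q r τ :=
  mul_pos (one_pos.trans_le (one_le_qPochInf_neg hq0 hq1 (by positivity)))
    (one_pos.trans_le (one_le_qPochInf_neg hq0 hq1 (by positivity)))

lemma nodeBound_inv (q r τ : ℝ) : nodeBound q r τ⁻¹ = nodeBound q r τ := by
  unfold nodeBound
  rw [div_inv_eq_mul, ← div_eq_mul_inv, mul_comm]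

lemma nodeBound_shift {q r τ : ℝ} (hq0 : 0 < q) (hq1 : q < 1) (hr : 0 ≤ r) (hτ : 0 < τ) :
    nodeBound q r (τ * q) = nodeBound q r τ * ((1 + r / τ) / (1 + r * q * τ)) := by
  unfold nodeBound
  have h1 := qPochInf_shift (-(r * q * τ)) hq0 hq1
  have h2 := qPochInf_shift (-(r * q / (τ * q))) hq0 hq1
  have e1 : -(r * q * τ) * q = -(r * q * (τ * q)) := by ring
  have e2 : -(r * q / (τ * q)) * q = -(r * q / τ) := by field_simp
  have e3 : 1 - -(r * q / (τ * q)) = 1 + r / τ := by field_simp; ring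
  rw [e1] at h1
  rw [e2, e3] at h2
  have h3 : 1 + r * q * τ ≠ 0 := by positivity
  rw [h1, h2]
  field_simp
  ring

lemma summable_nat_nodeBound {q α r : ℝ} (hq0 : 0 < q) (hq1 : q < 1) (hα : 0 < α) (hr : 0 ≤ r)
    (s : ℤ) :
    Summable fun n : ℕ =>
      nodeWeight q α n * node q α n ^ s * nodeBound q r (node q α n) ^ 2 := by
  have hpos : ∀ n : ℕ,
      0 < nodeWeight q α n * node q α n ^ s * nodeBound q r (node q α n) ^ 2 := fun n =>
    mul_pos (mul_pos (nodeWeight_pos hq0 hα _) (zpow_pos (node_pos hq0 hα _) _))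
      (pow_pos (nodeBound_pos hq0 hq1 hr (node_pos hq0 hα _)) 2)
  have hlim : Tendsto (fun n : ℕ => node q α n) atTop (𝓝 0) := by
    have := (tendsto_pow_atTop_nhds_zero_of_lt_one hq0.le hq1).const_mul α
    simpa [node] using this
  -- This is the ratio of consecutive terms: two of the four powers of τ from the weight absorb the
  -- poles of (1 + r/τ)², leaving a function continuous at τ = 0 with value 0.
  have hcont : ContinuousAt
      (fun τ : ℝ => q ^ s * q * τ ^ 2 * ((τ + r) / (1 + r * q * τ)) ^ 2) 0 := by
    fun_prop (disch := simp)
  refine summable_of_ratio_test_tendsto_lt_one zero_lt_one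
    (Eventually.of_forall fun n => (hpos n).ne') ?_
  have h0 := hcont.tendsto.comp hlim
  simp only [ne_eq, OfNat.ofNat_ne_zero, not_false_eq_true, zero_pow, mul_zero, zero_mul] at h0
  refine h0.congr fun n => ?_
  rw [Real.norm_of_nonneg (hpos _).le, Real.norm_of_nonneg (hpos _).le, eq_div_iff (hpos n).ne']
  have hτ := node_pos hq0 hα n
  have hw := nodeWeight_succ hq0 hα.ne' n
  have hn := node_succ hq0 α n
  have hb := nodeBound_shift hq0 hq1 hr hτ
  push_cast
  rw [hw, hn, hb, mul_zpow, Function.comp_apply]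
  generalize node q α n = τ at *
  have h3 : 1 + r * q * τ ≠ 0 := by positivity
  field_simp

lemma summable_nodeBound {q α r : ℝ} (hq0 : 0 < q) (hq1 : q < 1) (hα : 0 < α) (hr : 0 ≤ r)
    (s : ℤ) :
    Summable fun l : ℤ =>
      nodeWeight q α l * node q α l ^ s * nodeBound q r (node q α l) ^ 2 := by
  refine Summable.of_nat_of_neg (summable_nat_nodeBound hq0 hq1 hα hr s) ?_
  -- The inversion t ↦ 1/t sends the nodes of negative index to those of α⁻¹ with positive index. It
  -- preserves `nodeBound` and multiplies the weight by α² t², whence the exponent 2 - s.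
  refine ((summable_nat_nodeBound hq0 hq1 (inv_pos.2 hα) hr (2 - s)).mul_left (α ^ 2)).congr
    fun n => ?_
  have h1 : node q α (-n) = (node q α⁻¹ n)⁻¹ := by
    simp [node, mul_comm]
  have hτ := node_pos hq0 (inv_pos.2 hα) n
  have h2 : nodeWeight q α (-n) = nodeWeight q α⁻¹ n * node q α⁻¹ n ^ 2 * α ^ 2 := by
    unfold nodeWeight node
    have e : (2 * (-(n : ℤ)) ^ 2 - -n) = (2 * (n : ℤ) ^ 2 - n) + n + n := by ring
    rw [e, zpow_add₀ hq0.ne', zpow_add₀ hq0.ne', mul_neg, zpow_neg, inv_zpow]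
    field_simp
  rw [h1, h2, nodeBound_inv, inv_zpow, zpow_sub₀ hτ.ne']
  norm_cast
  field_simp

/-! ### The modifying products and their functional equations -/

/-- The product `∏_{k ≥ 1} (1 - c q^k t)(1 + c q^k / t)`. -/
def nodeProd (q : ℝ) (c t : ℂ) : ℂ := qPochInfC (c * q * t) q * qPochInfC (-(c * q / t)) q

lemma nodeProd_param_shift {q : ℝ} (hq0 : 0 < q) (hq1 : q < 1) (c t : ℂ) :
    nodeProd q c t = (1 - c * q * t) * (1 + c * q / t) * nodeProd q (c * q) t := by
  unfold nodeProd
  rw [qPochInfC_shift (c * q * t) hq0 hq1, qPochInfC_shift (-(c * q / t)) hq0 hq1]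
  ring_nf

lemma nodeProd_node_shift {q : ℝ} (hq0 : 0 < q) (hq1 : q < 1) (c : ℂ) {t : ℂ} (ht : t ≠ 0) :
    nodeProd q c (t * q) * (1 - c * q * t) = nodeProd q c t * (1 + c / t) := by
  have hq : (q : ℂ) ≠ 0 := by exact_mod_cast hq0.ne'
  unfold nodeProd
  rw [qPochInfC_shift (c * q * t) hq0 hq1, qPochInfC_shift (-(c * q / (t * q))) hq0 hq1]
  have e2 : -(c * q / (t * q)) * q = -(c * q / t) := by field_simp
  have e3 : 1 - -(c * q / (t * q)) = 1 + c / t := by field_simp; ring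
  rw [e2, e3]
  ring_nf

lemma norm_nodeProd_le {q r : ℝ} (hq0 : 0 < q) (hq1 : q < 1) {c : ℂ} (hc : ‖c‖ ≤ r) (t : ℝ) :
    ‖nodeProd q c t‖ ≤ nodeBound q r |t| := by
  unfold nodeProd nodeBound
  rw [norm_mul]
  have hr : 0 ≤ r := (norm_nonneg c).trans hc
  refine mul_le_mul (norm_qPochInfC_le _ hq0 hq1 ?_) (norm_qPochInfC_le _ hq0 hq1 ?_)
    (norm_nonneg _) (zero_le_one.trans (one_le_qPochInf_neg hq0 hq1 (by positivity)))
  · simp only [norm_mul, Complex.norm_real, Real.norm_eq_abs, abs_of_pos hq0]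
    gcongr
  · simp only [norm_neg, norm_div, norm_mul, Complex.norm_real, Real.norm_eq_abs, abs_of_pos hq0]
    gcongr

lemma tendsto_nodeProd {q : ℝ} (hq0 : 0 < q) (hq1 : q < 1) (c t : ℂ) :
    Tendsto (fun N : ℕ => nodeProd q (c * q ^ N) t) atTop (𝓝 1) := by
  have hq : Tendsto (fun N : ℕ => (q : ℂ) ^ N) atTop (𝓝 0) :=
    tendsto_pow_atTop_nhds_zero_of_norm_lt_one (by simpa [abs_of_pos hq0] using hq1)
  have h1 : Tendsto (fun N : ℕ => c * q ^ N * q * t) atTop (𝓝 0) := by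
    simpa using ((hq.const_mul c).mul_const (q : ℂ)).mul_const t
  have h2 : Tendsto (fun N : ℕ => -(c * q ^ N * q / t)) atTop (𝓝 0) := by
    simpa using (((hq.const_mul c).mul_const (q : ℂ)).div_const t).neg
  simpa [nodeProd] using
    ((tendsto_qPochInfC_zero hq0 hq1).comp h1).mul ((tendsto_qPochInfC_zero hq0 hq1).comp h2)

lemma hasSum_of_eq {ι : Type*} {f g : ι → ℂ} {a : ℂ} (h : HasSum f a) (hfg : ∀ i, g i = f i) :
    HasSum g a := by
  rwa [funext hfg]

lemma norm_nodeTerm_le {q α r : ℝ} (hq0 : 0 < q) (hq1 : q < 1) {c d : ℂ}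
    (hc : ‖c‖ ≤ r) (hd : ‖d‖ ≤ r) (s l : ℤ) :
    ‖(nodeWeight q α l : ℂ) * (node q α l : ℂ) ^ s * nodeProd q c (node q α l)
        * nodeProd q d (node q α l)‖
      ≤ nodeWeight q |α| l * node q |α| l ^ s * nodeBound q r (node q |α| l) ^ 2 := by
  simp only [norm_mul, norm_zpow, Complex.norm_real, Real.norm_eq_abs, abs_nodeWeight hq0]
  have h1 := norm_nodeProd_le hq0 hq1 hc (node q α l)
  have h2 := norm_nodeProd_le hq0 hq1 hd (node q α l)
  rw [abs_node hq0] at h1 h2 ⊢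
  have hw : 0 ≤ nodeWeight q |α| l := by rw [← abs_nodeWeight hq0]; positivity
  have hn : 0 ≤ node q |α| l := by rw [← abs_node hq0]; positivity
  have hB := (norm_nonneg _).trans h1
  rw [sq, mul_assoc]
  gcongr

lemma summable_nodeTerm {q α : ℝ} (hq0 : 0 < q) (hq1 : q < 1) (hα : α ≠ 0) (c d : ℂ) (s : ℤ) :
    Summable fun l : ℤ => (nodeWeight q α l : ℂ) * (node q α l : ℂ) ^ s
      * nodeProd q c (node q α l) * nodeProd q d (node q α l) :=
  Summable.of_norm_bounded
    (summable_nodeBound hq0 hq1 (abs_pos.2 hα) (le_max_of_le_left (norm_nonneg c)) s)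
    fun l => norm_nodeTerm_le hq0 hq1 (le_max_left ‖c‖ ‖d‖) (le_max_right ‖c‖ ‖d‖) s l

/-! ### Evaluation of the total mass -/

/-- The summand of `nodeMass`. -/
def massTerm (q α : ℝ) (c d : ℂ) (l : ℤ) : ℂ :=
  (nodeWeight q α l : ℂ) * (1 + (node q α l : ℂ) ^ 2)
    * (nodeProd q c (node q α l) * nodeProd q d (node q α l))

/-- The total mass of the `q⁻¹`-Hermite weight on the nodes, modified by two factors
`nodeProd`. -/
def nodeMass (q α : ℝ) (c d : ℂ) : ℂ := ∑' l : ℤ, massTerm q α c d l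

lemma massTerm_eq_add (q α : ℝ) (c d : ℂ) (l : ℤ) :
    massTerm q α c d l =
      (nodeWeight q α l : ℂ) * (node q α l : ℂ) ^ (0 : ℤ)
          * nodeProd q c (node q α l) * nodeProd q d (node q α l)
        + (nodeWeight q α l : ℂ) * (node q α l : ℂ) ^ (2 : ℤ)
          * nodeProd q c (node q α l) * nodeProd q d (node q α l) := by
  unfold massTerm
  rw [zpow_zero]
  norm_cast
  push_cast
  ring

lemma hasSum_massTerm {q α : ℝ} (hq0 : 0 < q) (hq1 : q < 1) (hα : α ≠ 0) (c d : ℂ) :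
    HasSum (massTerm q α c d) (nodeMass q α c d) := by
  refine Summable.hasSum ?_
  exact ((summable_nodeTerm hq0 hq1 hα c d 0).add (summable_nodeTerm hq0 hq1 hα c d 2)).congr
    fun l => (massTerm_eq_add q α c d l).symm

lemma hasSum_massTerm_mul_linear {q α : ℝ} (hq0 : 0 < q) (hq1 : q < 1) (hα : α ≠ 0) (c d : ℂ) :
    HasSum (fun l : ℤ => massTerm q α c d l
      * ((node q α l : ℂ) - 1 / (node q α l : ℂ) + c + d)) 0 := by
  -- The summand is g (l + 1) - g l. After `nodeProd_node_shift` this difference contains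
  -- t(t+c)(t+d) - (1-ct)(1-dt)/t, which equals (1 + t²)(t - 1/t + c + d).
  let g : ℤ → ℂ := fun l => (nodeWeight q α l : ℂ) * (node q α l : ℂ) ^ (-1 : ℤ)
    * nodeProd q c (node q α l) * nodeProd q d (node q α l)
    * ((1 - c * node q α l) * (1 - d * node q α l))
  have hg : Summable g := by
    refine (((summable_nodeTerm hq0 hq1 hα c d (-1)).add
      ((summable_nodeTerm hq0 hq1 hα c d 0).mul_left (-(c + d)))).add
      ((summable_nodeTerm hq0 hq1 hα c d 1).mul_left (c * d))).congr fun l => ?_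
    have ht : (node q α l : ℂ) ≠ 0 := by exact_mod_cast node_ne_zero hq0 hα l
    simp only [g, zpow_zero, zpow_one, zpow_neg]
    field_simp
    ring
  have hsum := (((Equiv.addRight (1 : ℤ)).hasSum_iff (f := g)).2 hg.hasSum).sub hg.hasSum
  rw [sub_self] at hsum
  refine hasSum_of_eq hsum fun l => ?_
  have hq : (q : ℂ) ≠ 0 := by exact_mod_cast hq0.ne'
  have ht : (node q α l : ℂ) ≠ 0 := by exact_mod_cast node_ne_zero hq0 hα l
  have hc := nodeProd_node_shift hq0 hq1 c ht
  have hd := nodeProd_node_shift hq0 hq1 d ht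
  simp only [g, Function.comp_apply, Equiv.coe_addRight, node_succ hq0, nodeWeight_succ hq0 hα,
    massTerm]
  push_cast
  generalize (node q α l : ℂ) = t at *
  generalize (nodeWeight q α l : ℂ) = w
  have e : w * (t ^ 4 * q) * (t * q) ^ (-1 : ℤ) * nodeProd q c (t * q) * nodeProd q d (t * q)
      * ((1 - c * (t * q)) * (1 - d * (t * q)))
      = w * t ^ 3 * (nodeProd q c (t * q) * (1 - c * q * t))
        * (nodeProd q d (t * q) * (1 - d * q * t)) := by
    rw [zpow_neg_one]
    field_simp
  rw [e, hc, hd, zpow_neg_one]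
  field_simp
  ring

lemma nodeMass_comm (q α : ℝ) (c d : ℂ) : nodeMass q α c d = nodeMass q α d c := by
  unfold nodeMass massTerm
  simp only [mul_comm (nodeProd q c _)]

lemma nodeMass_shift {q α : ℝ} (hq0 : 0 < q) (hq1 : q < 1) (hα : α ≠ 0) (c d : ℂ) :
    nodeMass q α c d = (1 + c * d * q) * nodeMass q α (c * q) d := by
  refine (hasSum_massTerm hq0 hq1 hα c d).unique ?_
  -- The factor relating parameters c and cq is (1 - cqt)(1 + cq/t) = (1 + cdq) - cq (t - 1/t + cq +
  -- d), and the last bracket sums to zero.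
  have h := ((hasSum_massTerm hq0 hq1 hα (c * q) d).mul_left (1 + c * d * q)).add
    ((hasSum_massTerm_mul_linear hq0 hq1 hα (c * q) d).mul_left (-(c * q)))
  rw [mul_zero, add_zero] at h
  refine hasSum_of_eq h fun l => ?_
  have ht : (node q α l : ℂ) ≠ 0 := by exact_mod_cast node_ne_zero hq0 hα l
  unfold massTerm
  rw [nodeProd_param_shift hq0 hq1 c]
  field_simp
  ring

/-- Each round shifts c and then d. Every shift multiplies cd by q, so N rounds collect 2N
consecutive factors. -/
lemma nodeMass_eq_qPoch_mul {q α : ℝ} (hq0 : 0 < q) (hq1 : q < 1) (hα : α ≠ 0) (c d : ℂ)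
    (N : ℕ) :
    nodeMass q α c d
      = qPoch (-(c * d * q)) (q : ℂ) (2 * N) * nodeMass q α (c * q ^ N) (d * q ^ N) := by
  induction N with
  | zero => simp [qPoch]
  | succ N ih =>
    rw [ih, nodeMass_shift hq0 hq1 hα, nodeMass_comm, nodeMass_shift hq0 hq1 hα, nodeMass_comm,
      show 2 * (N + 1) = 2 * N + 1 + 1 by ring, qPoch_succ, qPoch_succ]
    ring_nf

/-- Dominated convergence: the parameters c q^N, d q^N never exceed c, d in norm, so one `nodeBound`
majorant serves all N. -/
lemma tendsto_nodeMass {q α : ℝ} (hq0 : 0 < q) (hq1 : q < 1) (hα : α ≠ 0) (c d : ℂ) :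
    Tendsto (fun N : ℕ => nodeMass q α (c * q ^ N) (d * q ^ N)) atTop
      (𝓝 (nodeMass q α 0 0)) := by
  set r := max ‖c‖ ‖d‖
  have hr : 0 ≤ r := le_max_of_le_left (norm_nonneg c)
  have hqN : ∀ (x : ℂ) (N : ℕ), ‖x * (q : ℂ) ^ N‖ ≤ ‖x‖ := fun x N => by
    rw [norm_mul, norm_pow, Complex.norm_real, Real.norm_of_nonneg hq0.le]
    exact mul_le_of_le_one_right (norm_nonneg _) (pow_le_one₀ hq0.le hq1.le)
  refine tendsto_tsum_of_dominated_convergence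
    ((summable_nodeBound hq0 hq1 (abs_pos.2 hα) hr 0).add
      (summable_nodeBound hq0 hq1 (abs_pos.2 hα) hr 2)) (fun l => ?_)
    (Eventually.of_forall fun N l => ?_)
  · have := ((tendsto_nodeProd hq0 hq1 c (node q α l)).mul
      (tendsto_nodeProd hq0 hq1 d (node q α l))).const_mul
        ((nodeWeight q α l : ℂ) * (1 + (node q α l : ℂ) ^ 2))
    simpa [massTerm, nodeProd] using this
  · have hc := (hqN c N).trans (le_max_left ‖c‖ ‖d‖)
    have hd := (hqN d N).trans (le_max_right ‖c‖ ‖d‖)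
    rw [massTerm_eq_add]
    exact (norm_add_le _ _).trans (add_le_add (norm_nodeTerm_le hq0 hq1 hc hd 0 l)
      (norm_nodeTerm_le hq0 hq1 hc hd 2 l))

lemma nodeMass_eq_mul_zero {q α : ℝ} (hq0 : 0 < q) (hq1 : q < 1) (hα : α ≠ 0) (c d : ℂ) :
    nodeMass q α c d = qPochInfC (-(c * d * q)) q * nodeMass q α 0 0 := by
  have h2 : Tendsto (fun N : ℕ => 2 * N) atTop atTop :=
    tendsto_id.const_mul_atTop' (by norm_num)
  refine tendsto_nhds_unique tendsto_const_nhds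
    ((((tendsto_qPochInfC (-(c * d * q)) hq0 hq1).comp h2).mul
      (tendsto_nodeMass hq0 hq1 hα c d)).congr fun N => ?_)
  exact (nodeMass_eq_qPoch_mul hq0 hq1 hα c d N).symm

/-- At t = α q^l the two products contain (q^{l+1};q)_∞ and (q^{1-l};q)_∞, which vanish for l < 0
and l > 0 respectively. -/
lemma nodeMass_inv_neg {q α : ℝ} (hq0 : 0 < q) (hq1 : q < 1) (hα : α ≠ 0) :
    nodeMass q α (α : ℂ)⁻¹ (-α) =
      (1 + (α : ℂ) ^ 2) * qPochInfC q q ^ 2 * qPochInfC (-(α ^ 2 * q)) q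
        * qPochInfC (-(q / α ^ 2)) q := by
  have hα' : (α : ℂ) ≠ 0 := by exact_mod_cast hα
  have hq : (q : ℂ) ≠ 0 := by exact_mod_cast hq0.ne'
  unfold nodeMass
  rw [tsum_eq_single 0]
  · simp only [massTerm, nodeWeight, node, nodeProd]
    field_simp
    simp
  · intro l hl
    suffices nodeProd q (α : ℂ)⁻¹ (node q α l) * nodeProd q (-α : ℂ) (node q α l) = 0 by
      rw [massTerm, this, mul_zero]
    simp only [nodeProd, node]
    push_cast
    rcases lt_trichotomy l 0 with h | h | h
    · obtain ⟨n, rfl⟩ : ∃ n : ℕ, l = -(n + 1) := ⟨(-l - 1).toNat, by omega⟩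
      have e : (α : ℂ)⁻¹ * q * (α * (q : ℂ) ^ (-((n : ℤ) + 1))) = (q : ℂ)⁻¹ ^ n := by
        rw [neg_add, zpow_add₀ hq]
        simp
        field_simp
      rw [e, qPochInfC_inv_pow hq0 hq1]
      ring
    · exact absurd h hl
    · obtain ⟨n, rfl⟩ : ∃ n : ℕ, l = n + 1 := ⟨(l - 1).toNat, by omega⟩
      have e : -(-(α : ℂ) * q / (α * (q : ℂ) ^ ((n : ℤ) + 1))) = (q : ℂ)⁻¹ ^ n := by
        rw [zpow_add₀ hq]
        simp
        field_simp
      rw [e, qPochInfC_inv_pow hq0 hq1]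
      ring

/-- For c = 1/α, d = -α one has -cdq = q, so the one-term evaluation equals (q;q)_∞ times the wanted
constant; the nonzero factor (q;q)_∞ cancels. -/
lemma nodeMass_zero {q α : ℝ} (hq0 : 0 < q) (hq1 : q < 1) (hα : α ≠ 0) :
    nodeMass q α 0 0 =
      qPochInfC (-α ^ 2) q * qPochInfC (-q / α ^ 2) q * qPochInfC q q := by
  have hα' : (α : ℂ) ≠ 0 := by exact_mod_cast hα
  have h := nodeMass_eq_mul_zero hq0 hq1 hα (α : ℂ)⁻¹ (-α)
  rw [nodeMass_inv_neg hq0 hq1 hα] at h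
  have e : -((α : ℂ)⁻¹ * -α * q) = q := by field_simp
  have hne : qPochInfC q q ≠ 0 := by
    unfold qPochInfC
    simp only [sub_eq_add_neg]
    refine tprod_one_add_ne_zero_of_summable (fun k => ?_) (summable_norm_mul_pow (q : ℂ) hq0 hq1)
    rw [← sub_eq_add_neg, ← pow_succ', ← Complex.ofReal_pow, ← Complex.ofReal_one,
      ← Complex.ofReal_sub, Complex.ofReal_ne_zero]
    exact (sub_pos.2 (pow_lt_one₀ hq0.le hq1 k.succ_ne_zero)).ne'
  rw [e] at h
  apply mul_left_cancel₀ hne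
  rw [← h, qPochInfC_shift (-(α : ℂ) ^ 2) hq0 hq1]
  ring_nf

lemma nodeMass_eq {q α : ℝ} (hq0 : 0 < q) (hq1 : q < 1) (hα : α ≠ 0) (c d : ℂ) :
    nodeMass q α c d = qPochInfC (-(c * d * q)) q *
      (qPochInfC (-α ^ 2) q * qPochInfC (-q / α ^ 2) q * qPochInfC q q) := by
  rw [nodeMass_eq_mul_zero hq0 hq1 hα, nodeMass_zero hq0 hq1 hα]

/-! ### Identification of the weight of the first series -/

lemma qPochZ_succ {a q : ℝ} (h : ∀ l : ℤ, 1 - a * q ^ l ≠ 0) (l : ℤ) :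
    qPochZ a q (l + 1) = qPochZ a q l * (1 - a * q ^ l) := by
  rcases l with n | n
  · exact (qPoch_succ a q n).trans (by simp [qPochZ])
  · have h1 : 1 - a * (q ^ (n + 1))⁻¹ ≠ 0 := by
      have := h (-(n + 1 : ℕ))
      rwa [zpow_neg, zpow_natCast] at this
    rcases n with _ | n
    · have : Int.negSucc 0 + 1 = Int.ofNat 0 := rfl
      simp only [zero_add, pow_one] at h1
      rw [this]
      simp only [qPochZ, qPoch, Finset.range_zero, Finset.prod_empty, zpow_negSucc, zero_add,
        Finset.range_one, Finset.prod_singleton, pow_one]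
      rw [inv_mul_cancel₀ h1]
    · have : Int.negSucc (n + 1) + 1 = Int.negSucc n := rfl
      rw [this]
      simp only [qPochZ, zpow_negSucc]
      rw [Finset.prod_range_succ _ (n + 1), mul_inv, mul_assoc, inv_mul_cancel₀ h1, mul_one]

lemma eq_of_int_recurrence {f g r : ℤ → ℝ} (h0 : f 0 = g 0) (hr : ∀ l, r l ≠ 0)
    (hf : ∀ l, f (l + 1) = f l * r l) (hg : ∀ l, g (l + 1) = g l * r l) (l : ℤ) :
    f l = g l := by
  induction l with
  | zero => exact h0
  | succ n ih => rw [hf, hg, ih]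
  | pred n ih =>
    have h1 := hf (-n - 1)
    have h2 := hg (-n - 1)
    rw [sub_add_cancel] at h1 h2
    exact mul_right_cancel₀ (hr _) (h1.symm.trans (ih.trans h2))

lemma qPochInf_pos {a q : ℝ} (hq0 : 0 < q) (hq1 : q < 1) (ha : a ≤ 0) :
    0 < qPochInf a q := by
  have := one_le_qPochInf_neg hq0 hq1 (neg_nonneg.2 ha)
  rw [neg_neg] at this
  linarith

/-- Both sides agree at l = 0 and satisfy the same first-order recurrence in l, with nonzero ratio
t² q (t² + β) / (1 + β q² t²). -/
lemma symmASC_weight_eq {q α β : ℝ} (hq0 : 0 < q) (hq1 : q < 1) (hα : α ≠ 0) (hβ : 0 < β)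
    (l : ℤ) :
    (qPochZ (-α ^ 2 / β) (q ^ 2) l / qPochZ (-α ^ 2 * β * q ^ 2) (q ^ 2) l
        * α ^ (2 * l) * β ^ l * q ^ (l ^ 2))
        * (qPochInf (-α ^ 2 * β * q ^ 2) (q ^ 2) * qPochInf (-β * q ^ 2 / α ^ 2) (q ^ 2))
      = nodeWeight q α l * (qPochInf (-β * q ^ 2 * node q α l ^ 2) (q ^ 2)
          * qPochInf (-β * q ^ 2 / node q α l ^ 2) (q ^ 2)) := by
  have hQ0 : 0 < q ^ 2 := pow_pos hq0 2
  have hQ1 : q ^ 2 < 1 := by nlinarith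
  have hne : ∀ x : ℝ, 0 < x → ∀ l : ℤ, 1 - -x * (q ^ 2) ^ l ≠ 0 := fun x hx l => by
    have : 0 < (q ^ 2) ^ l := zpow_pos hQ0 l
    have : 0 < 1 - -x * (q ^ 2) ^ l := by nlinarith [mul_pos hx this]
    exact this.ne'
  have ea : -α ^ 2 / β = -(α ^ 2 / β) := by ring
  have eb : -α ^ 2 * β * q ^ 2 = -(α ^ 2 * β * q ^ 2) := by ring
  revert l
  refine eq_of_int_recurrence (r := fun l => node q α l ^ 2 * q * (node q α l ^ 2 + β)
    / (1 + β * q ^ 2 * node q α l ^ 2)) ?_ (fun l => ?_) (fun l => ?_) (fun l => ?_)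
  · have e : -α ^ 2 * β * q ^ 2 = -β * q ^ 2 * α ^ 2 := by ring
    rw [e]
    simp [qPochZ, qPoch, nodeWeight, node]
  · have : 0 < node q α l ^ 2 := by
      have := node_ne_zero hq0 hα l
      positivity
    positivity
  · have h1 := qPochZ_succ (hne _ (by positivity : 0 < α ^ 2 / β)) l
    have h2 := qPochZ_succ (hne _ (by positivity : 0 < α ^ 2 * β * q ^ 2)) l
    have e1 : α ^ (2 * (l + 1)) = α ^ (2 * l) * α ^ 2 := by
      rw [mul_add, zpow_add₀ hα]; norm_cast
    have e2 : β ^ (l + 1) = β ^ l * β := zpow_add_one₀ hβ.ne' l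
    have e3 : q ^ ((l + 1) ^ 2) = q ^ (l ^ 2) * (q ^ l) ^ 2 * q := by
      rw [← zpow_natCast (q ^ l) 2, ← zpow_mul, ← zpow_add₀ hq0.ne', ← zpow_add_one₀ hq0.ne']
      congr 1
      push_cast
      ring
    have e4 : (q ^ 2) ^ l = (q ^ l) ^ 2 := by
      rw [← zpow_natCast, ← zpow_natCast, ← zpow_mul, ← zpow_mul, mul_comm]
    have h3 := hne _ (by positivity : 0 < α ^ 2 * β * q ^ 2) l
    rw [ea, eb, h1, h2, e1, e2, e3]
    rw [e4] at h3 ⊢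
    unfold node
    have h4 : 1 + β * q ^ 2 * (α * q ^ l) ^ 2 = 1 - -(α ^ 2 * β * q ^ 2) * (q ^ l) ^ 2 := by ring
    rw [h4]
    generalize q ^ l = x at *
    generalize 1 - -(α ^ 2 * β * q ^ 2) * x ^ 2 = y at *
    field_simp
    ring
  · have ht := node_ne_zero hq0 hα l
    have h1 := qPochInf_shift (-β * q ^ 2 * node q α l ^ 2) hQ0 hQ1
    have h2 := qPochInf_shift (-β * q ^ 2 / (node q α l * q) ^ 2) hQ0 hQ1
    rw [nodeWeight_succ hq0 hα, node_succ hq0]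
    generalize node q α l = t at *
    have e1 : -β * q ^ 2 * t ^ 2 * q ^ 2 = -β * q ^ 2 * (t * q) ^ 2 := by ring
    have e2 : -β * q ^ 2 / (t * q) ^ 2 * q ^ 2 = -β * q ^ 2 / t ^ 2 := by field_simp
    rw [e1] at h1
    rw [e2] at h2
    rw [h1, h2]
    have h3 : 1 - -β * q ^ 2 * t ^ 2 ≠ 0 := by
      have : 0 ≤ β * q ^ 2 * t ^ 2 := by positivity
      nlinarith
    have h4 : 1 + β * q ^ 2 * t ^ 2 = 1 - -β * q ^ 2 * t ^ 2 := by ring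
    rw [h4]
    have h5 : 1 - -β * q ^ 2 / (t * q) ^ 2 = (t ^ 2 + β) / t ^ 2 := by
      field_simp
      ring
    rw [h5]
    generalize 1 - -β * q ^ 2 * t ^ 2 = y at *
    field_simp

lemma nodeProd_mul_neg {q : ℝ} (hq0 : 0 < q) (hq1 : q < 1) (c t : ℂ) :
    nodeProd q c t * nodeProd q (-c) t
      = qPochInfC (c ^ 2 * q ^ 2 * t ^ 2) (q ^ 2) * qPochInfC (c ^ 2 * q ^ 2 / t ^ 2) (q ^ 2) := by
  have h1 := qPochInfC_mul_neg (c * q * t) hq0 hq1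
  have h2 := qPochInfC_mul_neg (c * q / t) hq0 hq1
  rw [mul_pow, mul_pow] at h1
  rw [div_pow, mul_pow] at h2
  rw [← h1, ← h2]
  unfold nodeProd
  rw [show -c * q * t = -(c * q * t) by ring, show -(-c * q / t) = c * q / t by ring]
  ring

lemma massTerm_eq_weight {q α β : ℝ} (hq0 : 0 < q) (hq1 : q < 1) (hα : α ≠ 0) (hβ : 0 < β)
    {c : ℂ} (hc : c ^ 2 = -β) (l : ℤ) :
    massTerm q α c (-c) l =
      ((qPochZ (-α ^ 2 / β) (q ^ 2) l / qPochZ (-α ^ 2 * β * q ^ 2) (q ^ 2) l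
        * α ^ (2 * l) * β ^ l * (1 + α ^ 2 * q ^ (2 * l)) * q ^ (l ^ 2) : ℝ) : ℂ)
        * ((qPochInf (-α ^ 2 * β * q ^ 2) (q ^ 2)
          * qPochInf (-β * q ^ 2 / α ^ 2) (q ^ 2) : ℝ) : ℂ) := by
  have hQ0 : 0 < q ^ 2 := pow_pos hq0 2
  have hQ1 : q ^ 2 < 1 := by nlinarith
  have h := symmASC_weight_eq hq0 hq1 hα hβ l
  have ht : 1 + α ^ 2 * q ^ (2 * l) = 1 + node q α l ^ 2 := by
    unfold node
    rw [mul_comm 2 l, zpow_mul, mul_pow]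
    norm_cast
  rw [massTerm, nodeProd_mul_neg hq0 hq1, hc, ht]
  have e1 : (-β : ℂ) * q ^ 2 * (node q α l : ℂ) ^ 2
      = ((-β * q ^ 2 * node q α l ^ 2 : ℝ) : ℂ) := by push_cast; ring
  have e2 : (-β : ℂ) * q ^ 2 / (node q α l : ℂ) ^ 2
      = ((-β * q ^ 2 / node q α l ^ 2 : ℝ) : ℂ) := by push_cast; ring
  rw [e1, e2, qPochInfC_ofReal _ hQ0 hQ1, qPochInfC_ofReal _ hQ0 hQ1]
  norm_cast
  linear_combination (-(1 + node q α l ^ 2)) * h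

/-! ### The q-Chu–Vandermonde sum -/

/-- The `q`-Chu--Vandermonde sum for `₂φ₁(p^{-n}, a; c; p, p)`. -/
lemma q_chu_vandermonde {K : Type*} [Field K] {p : K} (hp0 : p ≠ 0)
    (hp : ∀ k : ℕ, 1 - p * p ^ k ≠ 0) (a : K) (n : ℕ) (c : K) (hc : ∀ k : ℕ, 1 - c * p ^ k ≠ 0) :
    ∑ k ∈ Finset.range (n + 1),
        qPoch (p ^ n)⁻¹ p k / qPoch p p k * p ^ k * (qPoch a p k / qPoch c p k)
      = ∏ i ∈ Finset.range n, (a - c * p ^ i) / (1 - c * p ^ i) := by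
  have hpp : ∀ k, qPoch p p k ≠ 0 := fun k => Finset.prod_ne_zero_iff.2 fun i _ => hp i
  induction n generalizing c with
  | zero => simp [qPoch]
  | succ n ih =>
    have hc' : ∀ k : ℕ, 1 - c * p * p ^ k ≠ 0 := fun k => by
      simpa [pow_succ', mul_assoc] using hc (k + 1)
    have hcp : ∀ k, qPoch (c * p) p k ≠ 0 := fun k => Finset.prod_ne_zero_iff.2 fun i _ => hc' i
    have h1c : 1 - c ≠ 0 := by simpa using hc 0
    -- A q-Pascal rule lowering n. Summation by parts moves the difference onto (a;p)_k/(c;p)_k, and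
    -- `hstep` turns that into the same sum with c replaced by cp; hence the induction generalizes
    -- c.
    have hrec : ∀ k : ℕ, qPoch (p ^ (n + 1))⁻¹ p (k + 1) / qPoch p p (k + 1) * p ^ (k + 1)
        = qPoch (p ^ n)⁻¹ p (k + 1) / qPoch p p (k + 1)
          - qPoch (p ^ n)⁻¹ p k / qPoch p p k := fun k => by
      have e : (p ^ (n + 1))⁻¹ * p = (p ^ n)⁻¹ := by
        rw [pow_succ]; field_simp
      have hk := hpp k
      have hk' := hp k
      rw [qPoch_succ_left (p ^ (n + 1))⁻¹, e, qPoch_succ (p ^ n)⁻¹, qPoch_succ p]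
      generalize qPoch (p ^ n)⁻¹ p k = x at *
      generalize qPoch p p k = y at *
      generalize hu : 1 - p * p ^ k = u at *
      field_simp
      rw [← hu]
      field_simp
      ring
    have hlast : qPoch (p ^ n)⁻¹ p (n + 1) = 0 := by
      rw [qPoch_succ, inv_mul_cancel₀ (pow_ne_zero n hp0), sub_self, mul_zero]
    have hstep : ∀ k : ℕ, qPoch a p k / qPoch c p k - qPoch a p (k + 1) / qPoch c p (k + 1)
        = (a - c) / (1 - c) * (p ^ k * (qPoch a p k / qPoch (c * p) p k)) := fun k => by
      have h1 : qPoch c p (k + 1) = (1 - c) * qPoch (c * p) p k := qPoch_succ_left c p k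
      have h2 := qPoch_succ c p k
      have h3 : qPoch c p k = (1 - c) * qPoch (c * p) p k / (1 - c * p ^ k) := by
        rw [eq_div_iff (hc k), ← h2, h1]
      rw [h1, h3, qPoch_succ]
      have := hcp k
      have := hc k
      field_simp
      ring
    rw [Finset.sum_range_succ', Finset.prod_range_succ']
    simp only [hrec, sub_mul, Finset.sum_sub_distrib]
    have hA := Finset.sum_range_succ'
      (fun k => qPoch (p ^ n)⁻¹ p k / qPoch p p k * (qPoch a p k / qPoch c p k)) (n + 1)
    rw [Finset.sum_range_succ, hlast] at hA
    have hB : ∑ k ∈ Finset.range (n + 1), qPoch (p ^ n)⁻¹ p k / qPoch p p k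
          * (qPoch a p k / qPoch c p k - qPoch a p (k + 1) / qPoch c p (k + 1))
        = (a - c) / (1 - c) * ∏ i ∈ Finset.range n, (a - c * p * p ^ i) / (1 - c * p * p ^ i) := by
      rw [← ih (c * p) hc', Finset.mul_sum]
      refine Finset.sum_congr rfl fun k _ => ?_
      rw [hstep]
      ring
    simp only [mul_sub, Finset.sum_sub_distrib] at hB
    have e1 : ∏ i ∈ Finset.range n, (a - c * p ^ (i + 1)) / (1 - c * p ^ (i + 1))
        = ∏ i ∈ Finset.range n, (a - c * p * p ^ i) / (1 - c * p * p ^ i) := by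
      refine Finset.prod_congr rfl fun i _ => ?_
      rw [pow_succ', mul_assoc]
    rw [e1]
    simp only [qPoch, Finset.range_zero, Finset.prod_empty, pow_zero, mul_one, zero_div,
      zero_mul, add_zero, div_one] at hA hB ⊢
    linear_combination hB - hA

/-! ### The polynomial basis adapted to the modifying products -/

lemma qPoch_add {K : Type*} [Field K] (a p : K) (j k : ℕ) :
    qPoch a p (j + k) = qPoch a p j * qPoch (a * p ^ j) p k := by
  unfold qPoch
  rw [Finset.prod_range_add]
  simp only [pow_add, mul_assoc]

open Polynomial in
/-- The polynomial in `z = 1/t - t` whose value is `(c t, -c/t; p)_k`. -/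
def phiPoly (c p : ℂ) (k : ℕ) : ℂ[X] :=
  ∏ j ∈ Finset.range k, (1 + C (c * p ^ j) * X - C ((c * p ^ j) ^ 2))

lemma eval_phiPoly (c p : ℂ) (k : ℕ) {t : ℂ} (ht : t ≠ 0) :
    (phiPoly c p k).eval (1 / t - t) = qPoch (c * t) p k * qPoch (-(c / t)) p k := by
  unfold phiPoly qPoch
  rw [Polynomial.eval_prod, ← Finset.prod_mul_distrib]
  refine Finset.prod_congr rfl fun j _ => ?_
  simp only [Polynomial.eval_sub, Polynomial.eval_add, Polynomial.eval_one, Polynomial.eval_mul,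
    Polynomial.eval_C, Polynomial.eval_X]
  field_simp
  ring

lemma coeff_phiPoly (c p : ℂ) (k : ℕ) :
    (∀ i, k < i → (phiPoly c p k).coeff i = 0) ∧
      (phiPoly c p k).coeff k = ∏ j ∈ Finset.range k, c * p ^ j := by
  induction k with
  | zero =>
    refine ⟨fun i hi => ?_, by simp [phiPoly]⟩
    simp [phiPoly, Polynomial.coeff_one, hi.ne']
  | succ k ih =>
    have hs : ∀ i, (phiPoly c p (k + 1)).coeff (i + 1) = (phiPoly c p k).coeff (i + 1)
        + (phiPoly c p k).coeff i * (c * p ^ k)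
        - (phiPoly c p k).coeff (i + 1) * (c * p ^ k) ^ 2 := fun i => by
      unfold phiPoly
      rw [Finset.prod_range_succ, mul_sub, mul_add, mul_one, ← mul_assoc, Polynomial.coeff_sub,
        Polynomial.coeff_add, Polynomial.coeff_mul_X, Polynomial.coeff_mul_C,
        Polynomial.coeff_mul_C]
    constructor
    · intro i hi
      obtain ⟨i, rfl⟩ : ∃ j, i = j + 1 := ⟨i - 1, by omega⟩
      rw [hs, ih.1 i (by omega), ih.1 (i + 1) (by omega)]
      ring
    · rw [hs, ih.1 (k + 1) (by omega), ih.2, Finset.prod_range_succ]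
      ring

lemma nodeProd_mul_eval_phiPoly {q : ℝ} (hq0 : 0 < q) (hq1 : q < 1) (c : ℂ) (k : ℕ) {t : ℂ}
    (ht : t ≠ 0) :
    nodeProd q c t * (phiPoly c (q : ℂ)⁻¹ k).eval (1 / t - t)
      = nodeProd q (c * (q : ℂ)⁻¹ ^ k) t := by
  have hq : (q : ℂ) ≠ 0 := by exact_mod_cast hq0.ne'
  rw [eval_phiPoly _ _ _ ht]
  induction k with
  | zero => simp [qPoch]
  | succ k ih =>
    rw [nodeProd_param_shift hq0 hq1 (c * (q : ℂ)⁻¹ ^ (k + 1)),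
      show c * (q : ℂ)⁻¹ ^ (k + 1) * q = c * (q : ℂ)⁻¹ ^ k by rw [pow_succ]; field_simp,
      ← ih, qPoch_succ, qPoch_succ]
    ring

lemma qPochInfC_inv_pow_mul (x : ℂ) {q : ℝ} (hq0 : 0 < q) (hq1 : q < 1) (m : ℕ) :
    qPochInfC (x * (q : ℂ)⁻¹ ^ m * q) q = qPoch x (q : ℂ)⁻¹ m * qPochInfC (x * q) q := by
  have hq : (q : ℂ) ≠ 0 := by exact_mod_cast hq0.ne'
  induction m with
  | zero => simp [qPoch]
  | succ m ih =>
    rw [qPochInfC_shift _ hq0 hq1,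
      show x * (q : ℂ)⁻¹ ^ (m + 1) * q = x * (q : ℂ)⁻¹ ^ m by rw [pow_succ]; field_simp,
      ih, qPoch_succ]
    ring

/-- Both polynomials are absorbed into the parameters, so the sum is the mass at (c q^{-k}, d
q^{-j}). The resulting (-cd;q⁻¹)_{j+k} is split with j first, leaving a k-dependence of
Chu–Vandermonde type. -/
lemma hasSum_massTerm_phiPoly {q α : ℝ} (hq0 : 0 < q) (hq1 : q < 1) (hα : α ≠ 0) (c d : ℂ)
    (k j : ℕ) :
    HasSum (fun l : ℤ => massTerm q α c d l
        * (phiPoly c (q : ℂ)⁻¹ k).eval (1 / (node q α l : ℂ) - node q α l)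
        * (phiPoly d (q : ℂ)⁻¹ j).eval (1 / (node q α l : ℂ) - node q α l))
      (nodeMass q α c d * (qPoch (-(c * d)) (q : ℂ)⁻¹ j
        * qPoch (-(c * d) * (q : ℂ)⁻¹ ^ j) (q : ℂ)⁻¹ k)) := by
  have h := hasSum_massTerm hq0 hq1 hα (c * (q : ℂ)⁻¹ ^ k) (d * (q : ℂ)⁻¹ ^ j)
  have e : -(c * (q : ℂ)⁻¹ ^ k * (d * (q : ℂ)⁻¹ ^ j) * q) = -(c * d) * (q : ℂ)⁻¹ ^ (j + k) * q := by
    rw [pow_add]; ring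
  rw [nodeMass_eq hq0 hq1 hα, e, qPochInfC_inv_pow_mul _ hq0 hq1, qPoch_add] at h
  rw [nodeMass_eq hq0 hq1 hα, ← neg_mul]
  rw [show ∀ a b f g : ℂ, a * b * (f * g) = f * g * a * b by intros; ring]
  refine hasSum_of_eq h fun l => ?_
  have ht : (node q α l : ℂ) ≠ 0 := by exact_mod_cast node_ne_zero hq0 hα l
  unfold massTerm
  rw [← nodeProd_mul_eval_phiPoly hq0 hq1 c k ht, ← nodeProd_mul_eval_phiPoly hq0 hq1 d j ht]
  ring

/-! ### The Al-Salam–Chihara polynomials in this basis -/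

open Polynomial in
/-- The symmetric Al-Salam--Chihara polynomial as a polynomial in `2x`. -/
def symmASCPoly (n : ℕ) (β q : ℝ) : ℂ[X] :=
  C (Complex.I ^ n * (qPoch (-β : ℂ) (q : ℂ)⁻¹ n / (√β : ℂ) ^ n)) *
    ∑ k ∈ Finset.range (n + 1),
      C (qPoch ((q : ℂ)⁻¹ ^ n)⁻¹ (q : ℂ)⁻¹ k / qPoch (q : ℂ)⁻¹ (q : ℂ)⁻¹ k * (q : ℂ)⁻¹ ^ k
        / qPoch (-β : ℂ) (q : ℂ)⁻¹ k) * phiPoly (Complex.I * √β) (q : ℂ)⁻¹ k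

lemma sqrt_mul_neg_sqrt {β : ℝ} (hβ : 0 < β) : ((√β : ℝ) : ℂ) * -((√β : ℝ) : ℂ) = -β := by
  rw [mul_neg, ← Complex.ofReal_mul, Real.mul_self_sqrt hβ.le]

lemma symmASC_eq_eval (n : ℕ) {β : ℝ} (hβ : 0 < β) (q x : ℝ) :
    symmASC n β q x = (symmASCPoly n β q).eval (2 * (x : ℂ)) := by
  unfold symmASC symmASCQ alSalamChihara phi32 symmASCPoly
  rw [sqrt_mul_neg_sqrt hβ, Polynomial.eval_mul, Polynomial.eval_C, ← mul_assoc,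
    Polynomial.eval_finsetSum]
  congr 1
  refine Finset.sum_congr rfl fun k _ => ?_
  set s : ℂ := Complex.exp (-(Real.arsinh x : ℂ)) with hs
  have hs0 : s ≠ 0 := Complex.exp_ne_zero _
  have hx : 2 * (x : ℂ) = 1 / s - s := by
    have h : (x : ℂ) = Complex.sinh (Real.arsinh x) := by
      rw [← Complex.ofReal_sinh, Real.sinh_arsinh]
    rw [h, Complex.sinh, hs, Complex.exp_neg]
    field_simp
  have hz : qPoch 0 (q : ℂ)⁻¹ k = 1 := by simp [qPoch]
  rw [hx, Polynomial.eval_mul, Polynomial.eval_C, eval_phiPoly _ _ _ hs0, hz]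
  have e1 : ((√β : ℝ) : ℂ) * (Complex.I * s) = Complex.I * √β * s := by ring
  have e2 : ((√β : ℝ) : ℂ) / (Complex.I * s) = -(Complex.I * √β / s) := by
    rw [← div_div, Complex.div_I]
    ring
  rw [e1, e2]
  ring

lemma symmASC_gridPt (n : ℕ) {β : ℝ} (hβ : 0 < β) (q α : ℝ) (l : ℤ) :
    symmASC n β q (gridPt q α l)
      = (symmASCPoly n β q).eval (1 / (node q α l : ℂ) - node q α l) := by
  rw [symmASC_eq_eval n hβ]
  congr 1
  unfold gridPt node
  push_cast
  ring

lemma coeff_symmASCPoly (n : ℕ) (β q : ℝ) :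
    (∀ i, n < i → (symmASCPoly n β q).coeff i = 0) ∧
      (symmASCPoly n β q).coeff n
        = Complex.I ^ n * (qPoch (-β : ℂ) (q : ℂ)⁻¹ n / (√β : ℂ) ^ n)
          * (qPoch ((q : ℂ)⁻¹ ^ n)⁻¹ (q : ℂ)⁻¹ n / qPoch (q : ℂ)⁻¹ (q : ℂ)⁻¹ n * (q : ℂ)⁻¹ ^ n
            / qPoch (-β : ℂ) (q : ℂ)⁻¹ n
            * ∏ j ∈ Finset.range n, Complex.I * √β * (q : ℂ)⁻¹ ^ j) := by
  unfold symmASCPoly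
  simp only [Polynomial.coeff_C_mul, Polynomial.finsetSum_coeff]
  constructor
  · intro i hi
    rw [Finset.sum_eq_zero, mul_zero]
    intro k hk
    rw [Finset.mem_range] at hk
    rw [(coeff_phiPoly _ _ k).1 i (by omega), mul_zero]
  · rw [Finset.sum_range_succ, Finset.sum_eq_zero, zero_add, (coeff_phiPoly _ _ n).2]
    intro k hk
    rw [(coeff_phiPoly _ _ k).1 n (Finset.mem_range.1 hk), mul_zero]

lemma one_sub_inv_pow_ne_zero {q : ℝ} (hq0 : 0 < q) (hq1 : q < 1) (k : ℕ) :
    1 - (q : ℂ)⁻¹ * (q : ℂ)⁻¹ ^ k ≠ 0 := by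
  rw [← pow_succ', sub_ne_zero, inv_pow, ne_comm]
  have : q ^ (k + 1) < 1 := pow_lt_one₀ hq0.le hq1 k.succ_ne_zero
  intro h
  rw [inv_eq_one] at h
  exact this.ne (by exact_mod_cast h)

lemma one_add_mul_inv_pow_ne_zero {q β : ℝ} (hq0 : 0 < q) (hβ : 0 < β) (k : ℕ) :
    1 - (-β : ℂ) * (q : ℂ)⁻¹ ^ k ≠ 0 := by
  have : 0 < 1 + β * q⁻¹ ^ k := by positivity
  rw [neg_mul, sub_neg_eq_add]
  exact_mod_cast this.ne'

lemma hasSum_massTerm_symmASCPoly_phiPoly {q α β : ℝ} (hq0 : 0 < q) (hq1 : q < 1) (hα : α ≠ 0)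
    (hβ : 0 < β) (n j : ℕ) :
    HasSum (fun l : ℤ => massTerm q α (Complex.I * √β) (-(Complex.I * √β)) l
        * (symmASCPoly n β q).eval (1 / (node q α l : ℂ) - node q α l)
        * (phiPoly (-(Complex.I * √β)) (q : ℂ)⁻¹ j).eval (1 / (node q α l : ℂ) - node q α l))
      (Complex.I ^ n * (qPoch (-β : ℂ) (q : ℂ)⁻¹ n / (√β : ℂ) ^ n)
        * (nodeMass q α (Complex.I * √β) (-(Complex.I * √β)) * qPoch (-β : ℂ) (q : ℂ)⁻¹ j
          * ∏ i ∈ Finset.range n, (-β * (q : ℂ)⁻¹ ^ j - -β * (q : ℂ)⁻¹ ^ i)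
            / (1 - -β * (q : ℂ)⁻¹ ^ i))) := by
  have hq : (q : ℂ) ≠ 0 := by exact_mod_cast hq0.ne'
  have hcd : -(Complex.I * (√β : ℂ) * -(Complex.I * √β)) = -β := by
    rw [← sqrt_mul_neg_sqrt hβ]
    linear_combination ((√β : ℂ) * √β) * Complex.I_mul_I
  -- Base q⁻¹, numerator parameter -β q^{-j}, denominator parameter -β.
  rw [← q_chu_vandermonde (inv_ne_zero hq) (one_sub_inv_pow_ne_zero hq0 hq1) _ n _
    (one_add_mul_inv_pow_ne_zero hq0 hβ), Finset.mul_sum]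
  have h := (hasSum_sum (s := Finset.range (n + 1)) fun k _ =>
    (hasSum_massTerm_phiPoly hq0 hq1 hα (Complex.I * √β) (-(Complex.I * √β)) k j).mul_left
      (qPoch ((q : ℂ)⁻¹ ^ n)⁻¹ (q : ℂ)⁻¹ k / qPoch (q : ℂ)⁻¹ (q : ℂ)⁻¹ k * (q : ℂ)⁻¹ ^ k
        / qPoch (-β : ℂ) (q : ℂ)⁻¹ k)).mul_left
      (Complex.I ^ n * (qPoch (-β : ℂ) (q : ℂ)⁻¹ n / (√β : ℂ) ^ n))
  rw [hcd] at h
  convert! hasSum_of_eq h fun l => ?_ using 1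
  · congr 1
    refine Finset.sum_congr rfl fun k _ => ?_
    ring
  · rw [symmASCPoly, Polynomial.eval_mul, Polynomial.eval_C, Polynomial.eval_finsetSum,
      mul_left_comm, mul_assoc, Finset.mul_sum, Finset.sum_mul]
    congr 1
    refine Finset.sum_congr rfl fun k _ => ?_
    rw [Polynomial.eval_mul, Polynomial.eval_C]
    ring

/-! ### Orthogonality and the squared norm -/

/-- A linear functional, given by a series, which annihilates `φ_j` for `j < n`, is determined on
polynomials of degree at most `n` by its value at `φ_n`, if `φ_j` has degree `j` for all `j`. -/
lemma hasSum_eval_of_hasSum_basis {ι : Type*} {v z : ι → ℂ} {φ : ℕ → Polynomial ℂ}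
    (hdeg : ∀ k i, k < i → (φ k).coeff i = 0) (hlead : ∀ k, (φ k).coeff k ≠ 0) {n : ℕ} {M : ℂ}
    (hlt : ∀ j < n, HasSum (fun l => v l * (φ j).eval (z l)) 0)
    (hn : HasSum (fun l => v l * (φ n).eval (z l)) M) (P : Polynomial ℂ)
    (hP : ∀ i, n < i → P.coeff i = 0) :
    HasSum (fun l => v l * P.eval (z l)) (P.coeff n / (φ n).coeff n * M) := by
  -- Removing the multiple of φ_m with the same coefficient in degree m lowers the degree.
  have hsub : ∀ m (R : Polynomial ℂ), (∀ i, m < i → R.coeff i = 0) → ∀ i, m ≤ i →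
      (R - Polynomial.C (R.coeff m / (φ m).coeff m) * φ m).coeff i = 0 := by
    intro m R hR i hi
    rw [Polynomial.coeff_sub, Polynomial.coeff_C_mul]
    rcases hi.eq_or_lt with rfl | hi
    · rw [div_mul_cancel₀ _ (hlead m), sub_self]
    · rw [hR i hi, hdeg m i hi, mul_zero, sub_zero]
  have hcomb : ∀ m (R : Polynomial ℂ) (a b : ℂ),
      HasSum (fun l => v l * (R - Polynomial.C (R.coeff m / (φ m).coeff m) * φ m).eval (z l)) a →
      HasSum (fun l => v l * (φ m).eval (z l)) b →
      HasSum (fun l => v l * R.eval (z l)) (a + R.coeff m / (φ m).coeff m * b) := by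
    intro m R a b ha hb
    refine hasSum_of_eq (ha.add (hb.mul_left (R.coeff m / (φ m).coeff m))) fun l => ?_
    simp only [Polynomial.eval_sub, Polynomial.eval_mul, Polynomial.eval_C]
    ring
  have hzero : ∀ m ≤ n, ∀ R : Polynomial ℂ, (∀ i, m ≤ i → R.coeff i = 0) →
      HasSum (fun l => v l * R.eval (z l)) 0 := by
    intro m
    induction m with
    | zero =>
      intro _ R hR
      have : R = 0 := Polynomial.ext fun i => by simpa using hR i i.zero_le
      simp [this, hasSum_zero]
    | succ m ih =>
      intro hm R hR
      simpa using hcomb m R 0 0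
        (ih (by omega) _ (hsub m R fun i hi => hR i hi)) (hlt m (by omega))
  simpa using hcomb n P 0 M (hzero n le_rfl _ (hsub n P hP)) hn

lemma qPoch_ne_zero {K : Type*} [Field K] {a p : K} (h : ∀ k : ℕ, 1 - a * p ^ k ≠ 0) (n : ℕ) :
    qPoch a p n ≠ 0 :=
  Finset.prod_ne_zero_iff.2 fun k _ => h k

/-- The value of the squared norm, in bases `q⁻¹` and `q`. -/
lemma qPoch_inv_base_eq {q β : ℂ} (hq : q ≠ 0) (hβ : β ≠ 0)
    (hqq : ∀ k : ℕ, 1 - q * q ^ k ≠ 0) (n : ℕ) :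
    (-1) ^ n * (qPoch (q⁻¹ ^ n)⁻¹ q⁻¹ n / qPoch q⁻¹ q⁻¹ n * q⁻¹ ^ n) * qPoch (-β) q⁻¹ n
        * ∏ i ∈ Finset.range n, (q⁻¹ ^ n - q⁻¹ ^ i)
      = β ^ n * (qPoch (-1 / β) q n * qPoch q q n) / q ^ (n ^ 2) := by
  set G := ∏ i ∈ Finset.range n, q ^ i with hG
  have hG0 : G ≠ 0 := Finset.prod_ne_zero_iff.2 fun i _ => pow_ne_zero i hq
  have hQ0 : qPoch q q n ≠ 0 := qPoch_ne_zero hqq n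
  have h1 : qPoch (q⁻¹ ^ n)⁻¹ q⁻¹ n = qPoch q q n := by
    unfold qPoch
    -- The factors 1 - q^{n-i} run through those of (q;q)_n in reverse order.
    rw [← Finset.prod_range_reflect]
    refine Finset.prod_congr rfl fun i hi => ?_
    rw [Finset.mem_range] at hi
    obtain ⟨k, rfl⟩ : ∃ k, n = i + 1 + k := ⟨n - (i + 1), by omega⟩
    rw [show i + 1 + k - 1 - i = k by omega, inv_pow, inv_inv, inv_pow, pow_add, pow_succ]
    field_simp
  have h2 : qPoch q⁻¹ q⁻¹ n = (-1) ^ n * qPoch q q n / (G * q ^ n) := by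
    rw [eq_div_iff (mul_ne_zero hG0 (pow_ne_zero n hq))]
    have e : G * q ^ n = ∏ i ∈ Finset.range n, q ^ i * q := by
      rw [Finset.prod_mul_distrib, Finset.prod_const, Finset.card_range]
    have e' : ((-1) ^ n : ℂ) = ∏ i ∈ Finset.range n, (-1 : ℂ) := by simp
    rw [e, e']
    unfold qPoch
    rw [← Finset.prod_mul_distrib, ← Finset.prod_mul_distrib]
    refine Finset.prod_congr rfl fun i _ => ?_
    rw [inv_pow]
    field_simp
    ring
  have h3 : qPoch (-β) q⁻¹ n = β ^ n * qPoch (-1 / β) q n / G := by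
    rw [eq_div_iff hG0]
    have e' : β ^ n = ∏ i ∈ Finset.range n, β := by simp
    rw [hG, e']
    unfold qPoch
    rw [← Finset.prod_mul_distrib, ← Finset.prod_mul_distrib]
    refine Finset.prod_congr rfl fun i _ => ?_
    rw [inv_pow]
    field_simp
    ring
  have h4 : ∏ i ∈ Finset.range n, (q⁻¹ ^ n - q⁻¹ ^ i) = qPoch q q n / q ^ (n ^ 2) := by
    rw [← h1, eq_div_iff (pow_ne_zero _ hq), sq, pow_mul]
    have e' : (q ^ n) ^ n = ∏ i ∈ Finset.range n, q ^ n := by simp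
    rw [e']
    unfold qPoch
    rw [← Finset.prod_mul_distrib]
    refine Finset.prod_congr rfl fun i _ => ?_
    rw [inv_pow]
    field_simp
  rw [h1, h2, h3, h4]
  have h5 : ((-1) ^ n : ℂ) ≠ 0 := by simp
  rw [inv_pow]
  field_simp

lemma coeff_phiPoly_self_ne_zero {c p : ℂ} (hc : c ≠ 0) (hp : p ≠ 0) (k : ℕ) :
    (phiPoly c p k).coeff k ≠ 0 := by
  rw [(coeff_phiPoly c p k).2]
  exact Finset.prod_ne_zero_iff.2 fun j _ => mul_ne_zero hc (pow_ne_zero j hp)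

lemma hasSum_massTerm_symmASCPoly_of_le {q α β : ℝ} (hq0 : 0 < q) (hq1 : q < 1) (hα : α ≠ 0)
    (hβ : 0 < β) {n m : ℕ} (hmn : m ≤ n) :
    HasSum (fun l : ℤ => massTerm q α (Complex.I * √β) (-(Complex.I * √β)) l
        * (symmASCPoly n β q).eval (1 / (node q α l : ℂ) - node q α l)
        * (symmASCPoly m β q).eval (1 / (node q α l : ℂ) - node q α l))
      (if n = m then (β : ℂ) ^ n * (qPoch (-1 / β : ℂ) q n * qPoch (q : ℂ) q n) / q ^ (n ^ 2)
        * nodeMass q α (Complex.I * √β) (-(Complex.I * √β)) else 0) := by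
  have hq : (q : ℂ) ≠ 0 := by exact_mod_cast hq0.ne'
  have hp : (q : ℂ)⁻¹ ≠ 0 := inv_ne_zero hq
  have hsβ : (√β : ℂ) ≠ 0 := by exact_mod_cast (Real.sqrt_pos.2 hβ).ne'
  have hβ' : (β : ℂ) ≠ 0 := by exact_mod_cast hβ.ne'
  have hc : Complex.I * (√β : ℂ) ≠ 0 := mul_ne_zero Complex.I_ne_zero hsβ
  have hlead := coeff_phiPoly_self_ne_zero (neg_ne_zero.2 hc) hp
  have key := hasSum_eval_of_hasSum_basis (fun k => (coeff_phiPoly _ _ k).1) hlead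
    (fun j hj => ?_) (hasSum_massTerm_symmASCPoly_phiPoly hq0 hq1 hα hβ n n)
    (symmASCPoly m β q) (fun i hi => (coeff_symmASCPoly m β q).1 i (by omega))
  · rcases hmn.lt_or_eq with h | rfl
    · rw [if_neg h.ne']
      rwa [(coeff_symmASCPoly m β q).1 n h, zero_div, zero_mul] at key
    · rw [if_pos rfl]
      convert key using 1
      have hqq : ∀ k : ℕ, 1 - (q : ℂ) * q ^ k ≠ 0 := fun k => by
        rw [← pow_succ', sub_ne_zero]
        exact_mod_cast (pow_lt_one₀ hq0.le hq1 k.succ_ne_zero).ne'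
      rw [(coeff_symmASCPoly m β q).2, (coeff_phiPoly _ _ m).2,
        ← qPoch_inv_base_eq hq hβ' hqq, Finset.prod_div_distrib]
      have e1 : ∏ i ∈ Finset.range m, (1 - -(β : ℂ) * (q : ℂ)⁻¹ ^ i)
        = qPoch (-β : ℂ) (q : ℂ)⁻¹ m := rfl
      have e2 : ∏ i ∈ Finset.range m, (-(β : ℂ) * (q : ℂ)⁻¹ ^ m - -β * (q : ℂ)⁻¹ ^ i)
          = (-β : ℂ) ^ m * ∏ i ∈ Finset.range m, ((q : ℂ)⁻¹ ^ m - (q : ℂ)⁻¹ ^ i) := by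
        simp only [← mul_sub, Finset.prod_mul_distrib, Finset.prod_const, Finset.card_range]
      have e3 : ∏ j ∈ Finset.range m, -(Complex.I * (√β : ℂ)) * (q : ℂ)⁻¹ ^ j
          = (-1) ^ m * ∏ j ∈ Finset.range m, Complex.I * (√β : ℂ) * (q : ℂ)⁻¹ ^ j := by
        simp only [neg_mul, Finset.prod_neg, Finset.card_range]
      have hP : ∏ j ∈ Finset.range m, Complex.I * (√β : ℂ) * (q : ℂ)⁻¹ ^ j ≠ 0 :=
        Finset.prod_ne_zero_iff.2 fun j _ => mul_ne_zero hc (pow_ne_zero j hp)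
      have hC : qPoch (-β : ℂ) (q : ℂ)⁻¹ m ≠ 0 :=
        qPoch_ne_zero (one_add_mul_inv_pow_ne_zero hq0 hβ) m
      -- The prefactor i^m/√β^m occurs twice, once in the tested polynomial and once in the leading
      -- coefficient; it cancels the (-β)^m extracted from the Chu–Vandermonde product.
      have hS : (Complex.I ^ m / (√β : ℂ) ^ m) ^ 2 * (-β : ℂ) ^ m = 1 := by
        rw [← div_pow, ← pow_mul, mul_comm m 2, pow_mul, ← mul_pow, div_pow, Complex.I_sq,
          ← Complex.ofReal_pow, Real.sq_sqrt hβ.le]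
        rw [show (-1 / (β : ℂ) * -β) = 1 by field_simp, one_pow]
      rw [e1, e2, e3]
      generalize ∏ j ∈ Finset.range m, Complex.I * (√β : ℂ) * (q : ℂ)⁻¹ ^ j = P at *
      generalize qPoch (-β : ℂ) (q : ℂ)⁻¹ m = Q at *
      generalize qPoch ((q : ℂ)⁻¹ ^ m)⁻¹ (q : ℂ)⁻¹ m / qPoch (q : ℂ)⁻¹ (q : ℂ)⁻¹ m
        * (q : ℂ)⁻¹ ^ m = R at *
      generalize ∏ i ∈ Finset.range m, ((q : ℂ)⁻¹ ^ m - (q : ℂ)⁻¹ ^ i) = T at *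
      generalize nodeMass q α (Complex.I * √β) (-(Complex.I * √β)) = K
      have hs : ((-1 : ℂ) ^ m) * (-1) ^ m = 1 := by rw [← mul_pow]; simp
      have hs0 : ((-1 : ℂ) ^ m) ≠ 0 := left_ne_zero_of_mul_eq_one hs
      calc (-1) ^ m * R * Q * T * K
          = (((-1) ^ m * (-1) ^ m) / (-1) ^ m) * ((Complex.I ^ m / (√β : ℂ) ^ m) ^ 2
            * (-β : ℂ) ^ m) * R * Q * T * K := by
              rw [hS]
              field_simp
        _ = _ := by
              rw [hs]
              field_simp
  · have h := hasSum_massTerm_symmASCPoly_phiPoly hq0 hq1 hα hβ n j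
    -- For j < n the factor with i = j vanishes.
    rwa [Finset.prod_eq_zero (Finset.mem_range.2 hj) (by rw [sub_self, zero_div]), mul_zero,
      mul_zero] at h

lemma hasSum_massTerm_symmASCPoly {q α β : ℝ} (hq0 : 0 < q) (hq1 : q < 1) (hα : α ≠ 0)
    (hβ : 0 < β) (n m : ℕ) :
    HasSum (fun l : ℤ => massTerm q α (Complex.I * √β) (-(Complex.I * √β)) l
        * (symmASCPoly n β q).eval (1 / (node q α l : ℂ) - node q α l)
        * (symmASCPoly m β q).eval (1 / (node q α l : ℂ) - node q α l))
      (if n = m then (β : ℂ) ^ n * (qPoch (-1 / β : ℂ) q n * qPoch (q : ℂ) q n) / q ^ (n ^ 2)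
        * nodeMass q α (Complex.I * √β) (-(Complex.I * √β)) else 0) := by
  rcases le_or_gt m n with h | h
  · exact hasSum_massTerm_symmASCPoly_of_le hq0 hq1 hα hβ h
  · have key := hasSum_massTerm_symmASCPoly_of_le hq0 hq1 hα hβ h.le
    rw [if_neg h.ne'] at key
    rw [if_neg h.ne]
    exact hasSum_of_eq key fun l => mul_right_comm _ _ _

/-! ### The second series: vanishing of all polynomial moments -/

/-- The summand `(-1)^l α^{2l} q^{l(l-1)} t^s` at the node `t = α q^l`. -/
def alternatingTerm (q α : ℝ) (s l : ℤ) : ℝ :=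
  (-1) ^ l * α ^ (2 * l) * q ^ (l * (l - 1)) * node q α l ^ s

lemma summable_alternatingTerm {q α : ℝ} (hq0 : 0 < q) (hq1 : q < 1) (hα : α ≠ 0) (s : ℤ) :
    Summable (alternatingTerm q α s) := by
  have hα' : 0 < |α| := abs_pos.2 hα
  have ha : 0 < √|α| := Real.sqrt_pos.2 hα'
  have hp0 : 0 < √q := Real.sqrt_pos.2 hq0
  have hp1 : √q < 1 := by simpa using Real.sqrt_lt_sqrt hq0.le hq1
  -- In base √q with parameter √|α| the node is x with x² = |t|, and the term has absolute value
  -- √|α| · `nodeWeight` · x^{2s-1}. With r = 0 the bound `nodeBound` is 1.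
  have h := (summable_nodeBound hp0 hp1 ha le_rfl (2 * s - 1)).mul_left √|α|
  refine Summable.of_norm (h.congr fun l => ?_)
  unfold alternatingTerm
  have hB : nodeBound (√q) 0 (node (√q) (√|α|) l) = 1 := by
    simp [nodeBound, qPochInf]
  have hn : node q |α| l = node (√q) (√|α|) l ^ 2 := by
    have e : (√q ^ l) ^ 2 = q ^ l := by
      rw [← zpow_natCast, ← zpow_mul, mul_comm, zpow_mul, zpow_natCast, Real.sq_sqrt hq0.le]
    rw [node, node, mul_pow, Real.sq_sqrt hα'.le, e]
  have hx := node_pos hp0 ha l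
  have hw : |α| ^ (2 * l) * q ^ (l * (l - 1)) * node (√q) (√|α|) l
      = √|α| * nodeWeight (√q) (√|α|) l := by
    have e1 : |α| ^ (2 * l) = √|α| ^ (4 * l) := by
      conv_lhs => rw [← Real.sq_sqrt hα'.le]
      rw [← zpow_natCast, ← zpow_mul]
      congr 1
      push_cast
      ring
    have e2 : q ^ (l * (l - 1)) * √q ^ l = √q ^ (2 * l ^ 2 - l) := by
      conv_lhs => rw [← Real.sq_sqrt hq0.le]
      rw [Real.sqrt_sq hp0.le, ← zpow_natCast, ← zpow_mul, ← zpow_add₀ hp0.ne']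
      congr 1
      push_cast
      ring
    rw [nodeWeight, node, e1, ← e2]
    ring
  rw [norm_mul, norm_mul, norm_mul, norm_zpow, norm_zpow, norm_zpow, norm_zpow, norm_neg,
    norm_one, one_zpow, one_mul, Real.norm_eq_abs, Real.norm_eq_abs, Real.norm_eq_abs,
    abs_of_pos hq0, abs_node hq0, hn, hB, one_pow, mul_one, zpow_sub₀ hx.ne', zpow_one,
    ← zpow_natCast, ← zpow_mul]
  push_cast
  rw [← mul_assoc, ← hw]
  field_simp

lemma alternatingTerm_add_two {q α : ℝ} (hq0 : 0 < q) (hα : α ≠ 0) (s l : ℤ) :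
    alternatingTerm q α (s + 2) l = -(q ^ s)⁻¹ * alternatingTerm q α s (l + 1) := by
  unfold alternatingTerm
  have hqs : q ^ s ≠ 0 := zpow_ne_zero _ hq0.ne'
  have e1 : α ^ (2 * (l + 1)) = α ^ (2 * l) * α ^ 2 := by
    rw [mul_add, zpow_add₀ hα]; norm_cast
  have e2 : q ^ ((l + 1) * (l + 1 - 1)) = q ^ (l * (l - 1)) * (q ^ l) ^ 2 := by
    rw [← zpow_natCast (q ^ l) 2, ← zpow_mul, ← zpow_add₀ hq0.ne']
    congr 1
    push_cast
    ring
  rw [node_succ hq0, mul_zpow, zpow_add₀ (node_ne_zero hq0 hα l), e1, e2,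
    zpow_add_one₀ (by norm_num : (-1 : ℝ) ≠ 0),
    show node q α l ^ (2 : ℤ) = node q α l ^ 2 by norm_cast]
  nth_rw 2 [node]
  rw [mul_pow]
  field_simp

/-- Completing the square: the shift l ↦ l + s of the index reverses the sign of the exponent s. -/
lemma alternatingTerm_neg {q α : ℝ} (hq0 : 0 < q) (hα : α ≠ 0) (s l : ℤ) :
    alternatingTerm q α (-s) (l + s) = (-1) ^ s * (q ^ s)⁻¹ * alternatingTerm q α s l := by
  unfold alternatingTerm node
  rw [zpow_add₀ (by norm_num : (-1 : ℝ) ≠ 0)]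
  have e1 : α ^ (2 * (l + s)) * α ^ (-s) = α ^ (2 * l) * α ^ s := by
    rw [← zpow_add₀ hα, ← zpow_add₀ hα]
    congr 1
    ring
  have e2 : q ^ ((l + s) * (l + s - 1)) * (q ^ (l + s)) ^ (-s)
      = (q ^ s)⁻¹ * q ^ (l * (l - 1)) * (q ^ l) ^ s := by
    rw [← zpow_neg, ← zpow_mul, ← zpow_mul, ← zpow_add₀ hq0.ne', ← zpow_add₀ hq0.ne',
      ← zpow_add₀ hq0.ne']
    congr 1
    ring
  rw [mul_zpow, mul_zpow]
  linear_combination ((-1) ^ l * (-1) ^ s * q ^ ((l + s) * (l + s - 1)) * (q ^ (l + s)) ^ (-s)) * e1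
    + ((-1) ^ l * (-1) ^ s * α ^ (2 * l) * α ^ s) * e2

/-- The moments `∑_l (-1)^l α^{2l} (1 + t²) q^{l(l-1)} t^s`, `t = α q^l`. -/
def alternatingMoment (q α : ℝ) (s : ℤ) : ℝ :=
  ∑' l, alternatingTerm q α s l + ∑' l, alternatingTerm q α (s + 2) l

lemma hasSum_alternatingMoment {q α : ℝ} (hq0 : 0 < q) (hq1 : q < 1) (hα : α ≠ 0) (s : ℤ) :
    HasSum (fun l : ℤ => (-1) ^ l * α ^ (2 * l) * (1 + α ^ 2 * q ^ (2 * l)) * q ^ (l * (l - 1))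
      * node q α l ^ s) (alternatingMoment q α s) := by
  have h := (summable_alternatingTerm hq0 hq1 hα s).hasSum.add
    (summable_alternatingTerm hq0 hq1 hα (s + 2)).hasSum
  convert! h using 2 with l
  have ht : 1 + α ^ 2 * q ^ (2 * l) = 1 + node q α l ^ 2 := by
    unfold node
    rw [mul_comm 2 l, zpow_mul, mul_pow]
    norm_cast
  unfold alternatingTerm
  rw [ht, zpow_add₀ (node_ne_zero hq0 hα l)]
  norm_cast
  ring

lemma alternatingMoment_eq {q α : ℝ} (hq0 : 0 < q) (hα : α ≠ 0) (s : ℤ) :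
    alternatingMoment q α s = (1 - (q ^ s)⁻¹) * ∑' l, alternatingTerm q α s l := by
  unfold alternatingMoment
  simp only [alternatingTerm_add_two hq0 hα s, tsum_mul_left]
  have h : ∑' l, alternatingTerm q α s (l + 1) = ∑' l, alternatingTerm q α s l :=
    (Equiv.addRight (1 : ℤ)).tsum_eq (alternatingTerm q α s)
  rw [h]
  ring

/-- Writing A_s for the sum of `alternatingTerm`, the moment is (1 - q^{-s}) A_s and A_{-s} = (-1)^s
q^{-s} A_s. -/
lemma alternatingMoment_neg {q α : ℝ} (hq0 : 0 < q) (hα : α ≠ 0) (s : ℤ) :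
    alternatingMoment q α (-s) = -(-1) ^ s * alternatingMoment q α s := by
  have hqs : q ^ s ≠ 0 := zpow_ne_zero _ hq0.ne'
  rw [alternatingMoment_eq hq0 hα, alternatingMoment_eq hq0 hα,
    ← (Equiv.addRight s).tsum_eq (alternatingTerm q α (-s))]
  simp only [Equiv.coe_addRight, alternatingTerm_neg hq0 hα s, tsum_mul_left]
  rw [zpow_neg]
  field_simp
  ring

lemma hasSum_alternating_pow {q α : ℝ} (hq0 : 0 < q) (hq1 : q < 1) (hα : α ≠ 0) (n : ℕ) :
    HasSum (fun l : ℤ => (-1) ^ l * α ^ (2 * l) * (1 + α ^ 2 * q ^ (2 * l)) * q ^ (l * (l - 1))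
      * (1 / node q α l - node q α l) ^ n) 0 := by
  have h := hasSum_sum (s := Finset.range (n + 1)) fun k _ =>
    (hasSum_alternatingMoment hq0 hq1 hα (2 * k - n)).mul_left ((-1) ^ k * (n.choose k : ℝ))
  have hS : ∑ k ∈ Finset.range (n + 1),
      (-1 : ℝ) ^ k * (n.choose k : ℝ) * alternatingMoment q α (2 * k - n) = 0 := by
    -- Under k ↦ n - k the order 2k - n changes sign, so the sum equals its own negative.
    have hrefl := Finset.sum_range_reflect
      (fun k : ℕ => (-1 : ℝ) ^ k * (n.choose k : ℝ) * alternatingMoment q α (2 * k - n)) (n + 1)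
    have hneg : ∑ k ∈ Finset.range (n + 1), (-1 : ℝ) ^ (n + 1 - 1 - k)
          * (n.choose (n + 1 - 1 - k) : ℝ) * alternatingMoment q α (2 * (n + 1 - 1 - k : ℕ) - n)
        = -∑ k ∈ Finset.range (n + 1),
          (-1 : ℝ) ^ k * (n.choose k : ℝ) * alternatingMoment q α (2 * k - n) := by
      rw [← Finset.sum_neg_distrib]
      refine Finset.sum_congr rfl fun k hk => ?_
      have hk : k ≤ n := Nat.lt_succ_iff.1 (Finset.mem_range.1 hk)
      obtain ⟨j, rfl⟩ := Nat.exists_eq_add_of_le hk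
      rw [Nat.add_sub_cancel, Nat.add_sub_cancel_left,
        ← Nat.choose_symm_add (a := k) (b := j)]
      have e : (2 * (j : ℤ) - ((k + j : ℕ) : ℤ)) = -(2 * (k : ℤ) - ((k + j : ℕ) : ℤ)) := by
        push_cast; ring
      have e2 : (-1 : ℝ) ^ (2 * (k : ℤ) - ((k + j : ℕ) : ℤ)) = (-1) ^ k * (-1) ^ j := by
        rw [show (2 * (k : ℤ) - ((k + j : ℕ) : ℤ)) = (k : ℤ) - j by push_cast; ring,
          zpow_sub₀ (by norm_num), zpow_natCast, zpow_natCast, div_eq_mul_inv, ← inv_pow]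
        norm_num
      have e3 : (-1 : ℝ) ^ j * (-1) ^ j = 1 := by rw [← mul_pow]; simp
      rw [e, alternatingMoment_neg hq0 hα, e2]
      linear_combination (-(-1 : ℝ) ^ k * ((k + j).choose k : ℝ)
        * alternatingMoment q α (2 * (k : ℤ) - ((k + j : ℕ) : ℤ))) * e3
    linarith
  rw [hS] at h
  convert! h using 2 with l
  have ht := node_ne_zero hq0 hα l
  rw [sub_eq_neg_add (1 / node q α l), add_pow, Finset.mul_sum]
  refine Finset.sum_congr rfl fun k hk => ?_
  have hk : k ≤ n := Nat.lt_succ_iff.1 (Finset.mem_range.1 hk)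
  obtain ⟨j, rfl⟩ := Nat.exists_eq_add_of_le hk
  rw [Nat.add_sub_cancel_left,
    show (2 * (k : ℤ) - ((k + j : ℕ) : ℤ)) = (k : ℤ) - j by push_cast; ring,
    zpow_sub₀ ht, zpow_natCast, zpow_natCast, neg_pow, div_pow, one_pow]
  field_simp

lemma hasSum_alternating_eval {q α : ℝ} (hq0 : 0 < q) (hq1 : q < 1) (hα : α ≠ 0)
    (P : Polynomial ℂ) :
    HasSum (fun l : ℤ =>
      (((-1) ^ l * α ^ (2 * l) * (1 + α ^ 2 * q ^ (2 * l)) * q ^ (l * (l - 1)) : ℝ) : ℂ)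
        * P.eval (1 / (node q α l : ℂ) - node q α l)) 0 := by
  induction P using Polynomial.induction_on' with
  | add P Q hP hQ => simpa only [Polynomial.eval_add, mul_add, add_zero] using hP.add hQ
  | monomial n a =>
    have h := (Complex.hasSum_ofReal.2 (hasSum_alternating_pow hq0 hq1 hα n)).mul_left a
    rw [Complex.ofReal_zero, mul_zero] at h
    refine hasSum_of_eq h fun l => ?_
    rw [Polynomial.eval_monomial]
    push_cast
    ring

/-! ### The two orthogonality relations -/

theorem mainTheorem7 (q α β : ℝ) (hq0 : 0 < q) (hq1 : q < 1) (hα : α ≠ 0) (hβ : 0 < β)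
    (n m : ℕ) :
    HasSum
      (fun l : ℤ =>
        ((qPochZ (-α ^ 2 / β) (q ^ 2) l / qPochZ (-α ^ 2 * β * q ^ 2) (q ^ 2) l
            * α ^ (2 * l) * β ^ l * (1 + α ^ 2 * q ^ (2 * l)) * q ^ (l ^ 2) : ℝ) : ℂ)
          * symmASC n β q (gridPt q α l) * symmASC m β q (gridPt q α l))
      (if n = m then
        ((β ^ n * (qPoch (-1 / β) q n * qPoch q q n) / q ^ (n ^ 2)
          * ((qPochInf (-α ^ 2) q * qPochInf (-q / α ^ 2) q * qPochInf (-β * q) q * qPochInf q q)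
            / (qPochInf (-α ^ 2 * β * q ^ 2) (q ^ 2)
              * qPochInf (-β * q ^ 2 / α ^ 2) (q ^ 2))) : ℝ) : ℂ)
       else 0)
    ∧
    HasSum
      (fun l : ℤ =>
        (((-1) ^ l * α ^ (2 * l) * (1 + α ^ 2 * q ^ (2 * l)) * q ^ (l * (l - 1)) : ℝ) : ℂ)
          * symmASC n β q (gridPt q α l)
          * symmASC m (1 / (β * q ^ 2)) q (gridPt q α l))
      0 := by
  constructor
  · have hQ0 : 0 < q ^ 2 := pow_pos hq0 2
    have hQ1 : q ^ 2 < 1 := by nlinarith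
    have hD : 0 < qPochInf (-α ^ 2 * β * q ^ 2) (q ^ 2) * qPochInf (-β * q ^ 2 / α ^ 2) (q ^ 2) := by
      have h1 : 0 ≤ α ^ 2 * β * q ^ 2 := by positivity
      have h2 : 0 ≤ β * q ^ 2 / α ^ 2 := by positivity
      exact mul_pos (qPochInf_pos hQ0 hQ1 (by linarith))
        (qPochInf_pos hQ0 hQ1 (by rw [neg_mul, neg_div]; linarith))
    have hD' : ((qPochInf (-α ^ 2 * β * q ^ 2) (q ^ 2)
        * qPochInf (-β * q ^ 2 / α ^ 2) (q ^ 2) : ℝ) : ℂ) ≠ 0 := by exact_mod_cast hD.ne'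
    have hc : (Complex.I * (√β : ℂ)) ^ 2 = -β := by
      rw [mul_pow, Complex.I_sq, ← Complex.ofReal_pow, Real.sq_sqrt hβ.le]
      ring
    have hcd : -(Complex.I * (√β : ℂ) * -(Complex.I * √β) * q) = ((-β * q : ℝ) : ℂ) := by
      push_cast
      linear_combination (q : ℂ) * hc
    have hmass : nodeMass q α (Complex.I * √β) (-(Complex.I * √β))
        = ((qPochInf (-α ^ 2) q * qPochInf (-q / α ^ 2) q * qPochInf (-β * q) q
          * qPochInf q q : ℝ) : ℂ) := by
      have e1 : -(α : ℂ) ^ 2 = ((-α ^ 2 : ℝ) : ℂ) := by push_cast; ring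
      have e2 : -(q : ℂ) / (α : ℂ) ^ 2 = ((-q / α ^ 2 : ℝ) : ℂ) := by push_cast; ring
      rw [nodeMass_eq hq0 hq1 hα, hcd, e1, e2]
      simp only [qPochInfC_ofReal _ hq0 hq1]
      push_cast
      ring
    -- `massTerm` carries the l-independent q²-products as an extra factor; dividing by them
    -- restores the stated weight and yields the denominator of the norm.
    have key := (hasSum_massTerm_symmASCPoly hq0 hq1 hα hβ n m).div_const
      ((qPochInf (-α ^ 2 * β * q ^ 2) (q ^ 2)
        * qPochInf (-β * q ^ 2 / α ^ 2) (q ^ 2) : ℝ) : ℂ)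
    rw [hmass] at key
    convert! hasSum_of_eq key fun l => ?_ using 1
    · split_ifs
      · simp only [qPoch]
        push_cast
        ring
      · rw [zero_div]
    · rw [symmASC_gridPt n hβ, symmASC_gridPt m hβ, massTerm_eq_weight hq0 hq1 hα hβ hc,
        eq_div_iff hD']
      ring
  · refine hasSum_of_eq
      (hasSum_alternating_eval hq0 hq1 hα (symmASCPoly n β q * symmASCPoly m (1 / (β * q ^ 2)) q))
      fun l => ?_
    rw [symmASC_gridPt n hβ, symmASC_gridPt m (by positivity), Polynomial.eval_mul, mul_assoc]

end
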